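/- **Setting.** Let $\gamma\subset\mathbb R^2$ be a smooth closed curve without self-intersections, with bounded interior $\Omega_{\rm in}$ and unbounded exterior $\Omega_{\rm out}$. Let $W\in L^\infty_{loc}(\mathbb R^2)$ be real, $W(x)\to+\infty$ as $|x|\to\infty$, and smooth near $\gamma$; let $H_0=-\Delta+W$ be the corresponding self-adjoint operator in $L^2(\mathbb R^2)$. Let $\mathcal W$ be the set of $v\in L^2(\mathbb R^2)$ such that $v|_{\Omega_{\rm in}}\in W_2^2(\Omega_{\rm in})$ and $v|_{\Omega_{\rm out}}=f_0|_{\Omega_{\rm out}}$ for some $f_0\in\operatorname{dom}H_0$. A choice of a unit-speed parametrization $\alpha$ of $\gamma$ (periodic in $s$, with period the length of $\gamma$) fixes the Frenet frame $\{\dot\alpha,\nu\}$, $\nu=(-\dot\alpha_2,\dot\alpha_1)$, and the signed curvature $\kappa=\det(\dot\alpha,\ddot\alpha)$. With respect to this frame let $v^\pm$ and $\partial_\nu v^\pm$ denote the one-sided traces on $\gamma$, where $+$ is the side into which $\nu$ points and $-$ the opposite side. Let potentials $V_\varepsilon$ be given for small $\varepsilon>0$ by $$V_\varepsilon(\alpha(s)+r\nu(s))=\varepsilon^{-2}V(\varepsilon^{-1}r)+\varepsilon^{-1}U(s,\varepsilon^{-1}r)\quad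 (|r|<\varepsilon)$$ and $V_\varepsilon=0$ outside the $\varepsilon$-neighbourhood of $\gamma$, where $V$ and $U$ are real smooth functions, $U$ is periodic in $s$, and $V$ and $U(s,\cdot)$ are supported in $[-1,1]$. Suppose that $-\frac{d^2}{dr^2}+V$ has a zero-energy resonance, i.e. there is a bounded nontrivial solution $h$ (a half-bound state) of $-h''+Vh=0$ on $\mathbb R$. Put $$\theta=\frac{h(+\infty)}{h(-\infty)},\qquad \mu(s)=\frac1{h^2(-\infty)}\int_{\mathbb R}U(s,r)h^2(r)\,dr,$$ and let $\mathcal H=-\Delta+W$ (acting in $\mathbb R^2\setminus\gamma$) be the operator in $L^2(\mathbb R^2)$ with the domain $$\operatorname{dom}\mathcal H=\Big\{v\in\mathcal W:\ v^+=\theta v^-,\quad \theta\,\partial_\nu v^+-\partial_\nu v^-=\big(\tfrac12(\theta^2-1)\kappa+\mu\big)v^-\ \text{ on }\gamma\Big\}.$$ **Proposition.** 1. The operator $\mathcal H$ does not depend on the choice of the Frenet frame: if $\tilde\alpha$ is any unit-speed parametrization of $\gamma$ (of either orientation), if the same potentials $V_\varepsilon$ are represented in the frame of $\tilde\alpha$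 by $\tilde V,\tilde U$ for all small $\varepsilon$, and if $\tilde h$ is any half-bound state of $-\frac{d^2}{dr^2}+\tilde V$, then the operator $\tilde{\mathcal H}$ defined by these data equals $\mathcal H$ (the same domain and the same action). 2. For the reversed parametrization $\tilde\alpha(s)=\alpha(-s)$, the same potentials $V_\varepsilon$ are represented by $\tilde V(r)=V(-r)$ and $\tilde U(s,r)=U(-s,-r)$, the function $\tilde h(r)=h(-r)$ is a half-bound state of $-\frac{d^2}{dr^2}+\tilde V$, and $$\tilde\theta=\theta^{-1},\qquad \tilde\kappa(s)=-\kappa(-s),\qquad \tilde\mu(s)=\theta^{-2}\mu(-s).$$ The traces at corresponding points of $\gamma$ change by $v^\pm\mapsto v^\mp$, $\partial_\nu v^\pm\mapsto-\partial_\nu v^\mp$, and at each point of $\gamma$ the transmission conditions with the new data are equivalent to those with the old data. -/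

import Mathlib

open MeasureTheory Filter Topology
open scoped ContDiff Laplacian

noncomputable section

/-! ## The plane, test functions, weak derivatives -/

/-- The Euclidean plane `ℝ²`. -/
abbrev Plane : Type := EuclideanSpace ℝ (Fin 2)

/-- The Hilbert space `L²(ℝ²)` of complex-valued functions. -/
abbrev L2Plane : Type := Lp ℂ 2 (volume : Measure Plane)

/-- `φ ∈ C_c^∞(O)`, as a function on the whole plane. -/
structure IsTest (O : Set Plane) (φ : Plane → ℝ) : Prop where
  smooth : ContDiff ℝ ∞ φ
  compact : HasCompactSupport φ
  supp : tsupport φ ⊆ O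

/-- The classical partial derivative `∂ᵢ φ`. -/
def partialDeriv (i : Fin 2) (φ : Plane → ℝ) (x : Plane) : ℝ :=
  fderiv ℝ φ x (EuclideanSpace.single i 1)

/-- `g` is the weak partial derivative `∂ᵢ f` in the open set `O`. -/
structure HasWeakPartial (O : Set Plane) (i : Fin 2) (f g : Plane → ℂ) : Prop where
  locInt_fun : LocallyIntegrableOn f O
  locInt_deriv : LocallyIntegrableOn g O
  integral_eq : ∀ φ : Plane → ℝ, IsTest O φ →
    ∫ x, partialDeriv i φ x • f x = - ∫ x, φ x • g x

/-- `f ∈ W_2^2(O)`: `f` and its weak derivatives of order one and two lie in `L²(O)`. -/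
def MemW22 (O : Set Plane) (f : Plane → ℂ) : Prop :=
  MemLp f 2 (volume.restrict O) ∧
  ∃ (G : Fin 2 → Plane → ℂ) (H : Fin 2 → Fin 2 → Plane → ℂ),
    (∀ i, MemLp (G i) 2 (volume.restrict O)) ∧
    (∀ i j, MemLp (H i j) 2 (volume.restrict O)) ∧
    (∀ i, HasWeakPartial O i f (G i)) ∧
    (∀ i j, HasWeakPartial O j (G i) (H i j))

/-! ## The curve, its arc-length parametrizations and their Frenet frames -/

/-- A unit-speed parametrization of the smooth closed curve `γ` without self-intersections,
extended periodically to `ℝ`; `L` is the length of `γ`.  It fixes an orientation of `γ` and thereby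
the Frenet frame `(α', ν)`.  A set `γ` is a smooth closed curve without self-intersections exactly
when such a parametrization exists. -/
structure FrenetFrame (γ : Set Plane) where
  L : ℝ
  L_pos : 0 < L
  α : ℝ → Plane
  smooth : ContDiff ℝ ∞ α
  periodic : Function.Periodic α L
  unit_speed : ∀ s, ‖deriv α s‖ = 1
  injOn : Set.InjOn α (Set.Ico 0 L)
  range_eq : Set.range α = γ

namespace FrenetFrame

variable {γ : Set Plane}

/-- The unit normal `ν = (-α₂', α₁')`. -/
def ν (F : FrenetFrame γ) (s : ℝ) : Plane := !₂[-(deriv F.α s 1), deriv F.α s 0]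

/-- The signed curvature `κ = det(α', α'')`. -/
def κ (F : FrenetFrame γ) (s : ℝ) : ℝ :=
  deriv F.α s 0 * deriv (deriv F.α) s 1 - deriv F.α s 1 * deriv (deriv F.α) s 0

/-- The point with local coordinates `(s, r)`: `x = α(s) + r ν(s)`. -/
def point (F : FrenetFrame γ) (s r : ℝ) : Plane := F.α s + r • F.ν s

/-- The same curve with the opposite orientation of the arc-length parameter. -/
def reverse (F : FrenetFrame γ) : FrenetFrame γ where
  L := F.L
  L_pos := F.L_pos
  α := fun s => F.α (-s)
  smooth := F.smooth.comp contDiff_neg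
  periodic := fun s => by
    show F.α (-(s + F.L)) = F.α (-s)
    rw [← F.periodic (-(s + F.L))]; congr 1; ring
  unit_speed := fun s => by
    rw [deriv_comp_neg, norm_neg]; exact F.unit_speed _
  injOn := by
    have key : ∀ s ∈ Set.Ico 0 F.L, ∃ s' ∈ Set.Ico 0 F.L, F.α (-s) = F.α s' ∧
        ((s = 0 ∧ s' = 0) ∨ (0 < s ∧ s' = F.L - s)) := by
      intro s hs
      rcases hs.1.eq_or_lt with h0 | h0
      · exact ⟨0, ⟨le_rfl, F.L_pos⟩, by simp [← h0], Or.inl ⟨h0.symm, rfl⟩⟩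
      · refine ⟨F.L - s, ⟨by linarith [hs.2], by linarith⟩, ?_, Or.inr ⟨h0, rfl⟩⟩
        rw [← F.periodic (-s)]; congr 1; ring
    intro s hs t ht hst
    obtain ⟨s', hs', es, cs⟩ := key s hs
    obtain ⟨t', ht', et, ct⟩ := key t ht
    have hst' : s' = t' := F.injOn hs' ht' (by rw [← es, ← et]; exact hst)
    have h1 := hs.2
    have h2 := ht.2
    rcases cs with ⟨a, b⟩ | ⟨a, b⟩ <;> rcases ct with ⟨c, d⟩ | ⟨c, d⟩ <;> linarith
  range_eq := by
    exact ((Equiv.neg ℝ).surjective.range_comp F.α).trans F.range_eq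

/-- The one-sided trace, in the sense of `L²(γ)`: the function `u`, given in the local coordinates
`(s, r)`, tends to `g` in `L²(γ)` as `r` tends to zero (for almost all `r`) from the side described
by the filter `side`. -/
def HasTrace (F : FrenetFrame γ) (side : Filter ℝ) (u : ℝ → ℝ → ℂ) (g : ℝ → ℂ) : Prop :=
  Function.Periodic g F.L ∧ MemLp g 2 (volume.restrict (Set.Ioc 0 F.L)) ∧
  Tendsto (fun r => eLpNorm (fun s => u s r - g s) 2 (volume.restrict (Set.Ioc 0 F.L)))
    (side ⊓ ae volume) (𝓝 0)

/-- `g` is the trace `u⁺` on `γ`, taken from the side into which `ν` points. -/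
def HasTracePlus (F : FrenetFrame γ) (u : Plane → ℂ) (g : ℝ → ℂ) : Prop :=
  F.HasTrace (𝓝[>] 0) (fun s r => u (F.point s r)) g

/-- `g` is the trace `u⁻` on `γ`, taken from the side into which `-ν` points. -/
def HasTraceMinus (F : FrenetFrame γ) (u : Plane → ℂ) (g : ℝ → ℂ) : Prop :=
  F.HasTrace (𝓝[<] 0) (fun s r => u (F.point s r)) g

/-- The derivative in the direction `ν(s)` at the point `(s, r)` of a function with gradient
`G`. -/
def normalDeriv (F : FrenetFrame γ) (G : Fin 2 → Plane → ℂ) (s r : ℝ) : ℂ :=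
  ∑ i, (F.ν s i : ℂ) * G i (F.point s r)

/-- `g` is the trace `∂_ν u⁺` on `γ`, for a function `u` with gradient `G`. -/
def HasNormalTracePlus (F : FrenetFrame γ) (G : Fin 2 → Plane → ℂ) (g : ℝ → ℂ) : Prop :=
  F.HasTrace (𝓝[>] 0) (F.normalDeriv G) g

/-- `g` is the trace `∂_ν u⁻` on `γ`, for a function `u` with gradient `G`. -/
def HasNormalTraceMinus (F : FrenetFrame γ) (G : Fin 2 → Plane → ℂ) (g : ℝ → ℂ) : Prop :=
  F.HasTrace (𝓝[<] 0) (F.normalDeriv G) g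

end FrenetFrame

/-- The bounded domain enclosed by `γ`. -/
def inside (γ : Set Plane) : Set Plane :=
  {x | x ∈ γᶜ ∧ Bornology.IsBounded (connectedComponentIn γᶜ x)}

/-- The unbounded domain with boundary `γ`. -/
def outside (γ : Set Plane) : Set Plane :=
  {x | x ∈ γᶜ ∧ ¬ Bornology.IsBounded (connectedComponentIn γᶜ x)}

/-! ## The background potential and the unperturbed operator -/

/-- A real potential `W ∈ L^∞_loc(ℝ²)` which tends to `+∞` at infinity and is smooth in a
neighbourhood of `γ`. -/
structure BackgroundPotential (γ : Set Plane) where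
  W : Plane → ℝ
  aemeasurable : AEMeasurable W volume
  locallyBounded : ∀ K : Set Plane, IsCompact K →
    ∃ C : ℝ, ∀ᵐ x ∂(volume : Measure Plane), x ∈ K → |W x| ≤ C
  tendsto_infty : ∀ M : ℝ, ∃ R : ℝ, ∀ᵐ x ∂(volume : Measure Plane), R ≤ ‖x‖ → M ≤ W x
  smooth_near : ∃ O : Set Plane, IsOpen O ∧ γ ⊆ O ∧ ContDiffOn ℝ ∞ W O

/-- `-Δ f + W f = g` in the sense of distributions in `O`. -/
def IsWeakAction (W : Plane → ℝ) (O : Set Plane) (f g : Plane → ℂ) : Prop :=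
  ∀ φ : Plane → ℝ, IsTest O φ →
    ∫ x, (-(Δ φ) x + W x * φ x) • f x = ∫ x, φ x • g x

/-- `f ∈ dom H₀`, where `H₀ = -Δ + W` is the self-adjoint operator in `L²(ℝ²)`.  As `W` is locally
bounded and bounded below, `-Δ + W` is essentially self-adjoint on `C_c^∞(ℝ²)`, and `H₀` is its
maximal realization: `f ∈ L²(ℝ²)` with `-Δ f + W f ∈ L²(ℝ²)`. -/
def MemDomH0 (W : Plane → ℝ) (f : L2Plane) : Prop :=
  ∃ g : L2Plane, IsWeakAction W Set.univ f g

/-- The space `𝒲`: functions of class `W_2^2` in the bounded domain, which coincide with an element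
of `dom H₀` in the unbounded one. -/
def MemCalW (γ : Set Plane) (W : Plane → ℝ) (v : L2Plane) : Prop :=
  MemW22 (inside γ) v ∧
  ∃ f₀ : L2Plane, MemDomH0 W f₀ ∧ ∀ᵐ x ∂(volume : Measure Plane), x ∈ outside γ → v x = f₀ x

/-! ## The short-range potentials and the zero-energy resonance -/

/-- The profiles `V`, `U` of the short-range potentials: smooth functions `V(n)`, `U(s, n)`, with
`U` periodic in the arc-length parameter, supported in `-1 ≤ n ≤ 1`. -/
structure Profile (L : ℝ) where
  V : ℝ → ℝ
  U : ℝ → ℝ → ℝ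
  smooth_V : ContDiff ℝ ∞ V
  smooth_U : ContDiff ℝ ∞ (Function.uncurry U)
  periodic_U : Function.Periodic U L
  supp_V : ∀ n, n ∉ Set.Icc (-1 : ℝ) 1 → V n = 0
  supp_U : ∀ s n, n ∉ Set.Icc (-1 : ℝ) 1 → U s n = 0

/-- The profiles of the same potentials with respect to the reversed arc-length parameter. -/
def Profile.reverse {L : ℝ} (P : Profile L) : Profile L where
  V := fun n => P.V (-n)
  U := fun s n => P.U (-s) (-n)
  smooth_V := P.smooth_V.comp contDiff_neg
  smooth_U := P.smooth_U.comp (contDiff_neg (F := ℝ × ℝ))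
  periodic_U := fun s => by
    funext n
    show P.U (-(s + L)) (-n) = P.U (-s) (-n)
    rw [← P.periodic_U (-(s + L))]; congr 1; ring
  supp_V := fun n hn => P.supp_V _ fun h => hn ⟨by linarith [h.2], by linarith [h.1]⟩
  supp_U := fun s n hn => P.supp_U _ _ fun h => hn ⟨by linarith [h.2], by linarith [h.1]⟩

/-- For all small `ε`, the function `Vε ε` on the plane vanishes outside of the `ε`-neighbourhood of
`γ`, and there `V_ε(α(s) + r ν(s)) = ε⁻² V(r/ε) + ε⁻¹ U(s, r/ε)`. -/
def IsPotentialFamily {γ : Set Plane} (F : FrenetFrame γ) (P : Profile F.L)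
    (Vε : ℝ → Plane → ℝ) : Prop :=
  ∀ᶠ ε in 𝓝[>] (0 : ℝ),
    (∀ s, ∀ r ∈ Set.Ioo (-ε) ε,
      Vε ε (F.point s r) = (ε ^ 2)⁻¹ * P.V (ε⁻¹ * r) + ε⁻¹ * P.U s (ε⁻¹ * r)) ∧
    ∀ x ∉ Metric.thickening ε γ, Vε ε x = 0

/-- `h` is a half-bound state of `-d²/dr² + V`: a nontrivial solution of `-h'' + V h = 0` which is
bounded on the whole line.  The operator has a zero-energy resonance if and only if a half-bound
state exists. -/
structure IsHalfBoundState (V h : ℝ → ℝ) : Prop where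
  smooth : ContDiff ℝ 2 h
  equation : ∀ r, -(deriv (deriv h) r) + V r * h r = 0
  nontrivial : ∃ r, h r ≠ 0
  bounded : ∃ C, ∀ r, |h r| ≤ C

/-- `θ = h(+∞) / h(-∞)`. -/
def thetaOf (h : ℝ → ℝ) : ℝ := limUnder atTop h / limUnder atBot h

/-- `μ(s) = h(-∞)⁻² ∫ U(s, r) h(r)² dr`. -/
def muOf (U : ℝ → ℝ → ℝ) (h : ℝ → ℝ) (s : ℝ) : ℝ :=
  1 / (limUnder atBot h) ^ 2 * ∫ r, U s r * h r ^ 2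

/-! ## The limit operator -/

/-- The transmission conditions
`v⁺ = θ v⁻`, `θ ∂_ν v⁺ - ∂_ν v⁻ = (½ (θ² - 1) κ + μ) v⁻`
at a point of `γ`, for the values `v⁺`, `v⁻`, `∂_ν v⁺`, `∂_ν v⁻` at that point. -/
def TransmissionConditions (θ κ μ : ℝ) (vp vm dp dm : ℂ) : Prop :=
  vp = θ * vm ∧ θ * dp - dm = ((1 / 2 * (θ ^ 2 - 1) * κ + μ : ℝ) : ℂ) * vm

/-- `v` satisfies the transmission conditions with the parameters `θ`, `μ` (and the curvature of the
frame) almost everywhere on `γ`.  Here `u` is a representative of `v`, and `G` one of its weak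
gradient in `ℝ² ∖ γ`. -/
def SatisfiesTransmission {γ : Set Plane} (F : FrenetFrame γ) (θ : ℝ) (μ : ℝ → ℝ)
    (v : L2Plane) : Prop :=
  ∃ (u : Plane → ℂ) (G : Fin 2 → Plane → ℂ) (vp vm dp dm : ℝ → ℂ),
    Measurable u ∧ (∀ i, Measurable (G i)) ∧
    (∀ᵐ x ∂(volume : Measure Plane), u x = v x) ∧
    (∀ i, HasWeakPartial γᶜ i u (G i)) ∧
    F.HasTracePlus u vp ∧ F.HasTraceMinus u vm ∧
    F.HasNormalTracePlus G dp ∧ F.HasNormalTraceMinus G dm ∧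
    ∀ᵐ s ∂(volume : Measure ℝ),
      TransmissionConditions θ (F.κ s) (μ s) (vp s) (vm s) (dp s) (dm s)

/-! ## Auxiliary facts: the domain is a linear subspace, and `-Δ v + W v` is a well-defined element
of `L²(ℝ²)` for each `v ∈ 𝒲` -/

namespace SchrodingerCurve

variable {γ : Set Plane}

lemma isCompact_curve (F : FrenetFrame γ) : IsCompact γ := by
  have h : γ = F.α '' Set.Icc 0 F.L := by
    have := F.periodic.image_Icc F.L_pos 0
    rw [zero_add] at this
    exact (this.trans F.range_eq).symm
  rw [h]
  exact isCompact_Icc.image F.smooth.continuous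

lemma continuous_point (F : FrenetFrame γ) (r : ℝ) : Continuous fun s => F.point s r := by
  have hd : Continuous (deriv F.α) := F.smooth.continuous_deriv (by simp)
  unfold FrenetFrame.point FrenetFrame.ν
  refine F.smooth.continuous.add (Continuous.const_smul ?_ r)
  refine (PiLp.continuous_toLp 2 _).comp (continuous_pi fun i => ?_)
  fin_cases i
  · exact ((PiLp.continuous_apply 2 _ 1).comp hd).neg
  · exact (PiLp.continuous_apply 2 _ 0).comp hd

lemma continuous_nu (F : FrenetFrame γ) (i : Fin 2) : Continuous fun s => F.ν s i := by
  have hd : Continuous (deriv F.α) := F.smooth.continuous_deriv (by simp)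
  unfold FrenetFrame.ν
  fin_cases i
  · exact ((PiLp.continuous_apply 2 _ 1).comp hd).neg
  · exact (PiLp.continuous_apply 2 _ 0).comp hd

lemma volume_curve (F : FrenetFrame γ) : volume γ = 0 := by
  let f : Plane → Plane := fun x => F.α (x 0)
  have hf : Differentiable ℝ f :=
    (F.smooth.differentiable (by simp)).comp (EuclideanSpace.proj (𝕜 := ℝ) (0 : Fin 2)).differentiable
  let S : Submodule ℝ Plane := LinearMap.ker (EuclideanSpace.proj (𝕜 := ℝ) (1 : Fin 2)).toLinearMap
  have hS : volume (S : Set Plane) = 0 := by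
    refine Measure.addHaar_submodule _ _ fun h => ?_
    have : (EuclideanSpace.single (1 : Fin 2) (1 : ℝ)) ∈ S := h ▸ Submodule.mem_top
    simp [S] at this
  have := addHaar_image_eq_zero_of_differentiableOn_of_addHaar_eq_zero volume
    hf.differentiableOn hS
  refine measure_mono_null ?_ this
  rw [← F.range_eq]
  rintro _ ⟨s, rfl⟩
  exact ⟨EuclideanSpace.single 0 s, by simp [S], by simp [f]⟩

lemma hasTrace_add {F : FrenetFrame γ} {side : Filter ℝ} {u w : ℝ → ℝ → ℂ} {g k : ℝ → ℂ}
    (hu : F.HasTrace side u g) (hw : F.HasTrace side w k)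
    (mu : ∀ r, Measurable fun s => u s r) (mw : ∀ r, Measurable fun s => w s r) :
    F.HasTrace side (fun s r => u s r + w s r) (g + k) := by
  obtain ⟨pu, lu, tu⟩ := hu
  obtain ⟨pw, lw, tw⟩ := hw
  refine ⟨pu.add pw, lu.add lw, ?_⟩
  have h := tu.add tw
  rw [add_zero] at h
  refine tendsto_of_tendsto_of_tendsto_of_le_of_le tendsto_const_nhds h
    (fun r => bot_le) (fun r => ?_)
  have key : (fun s => u s r + w s r - (g + k) s)
      = (fun s => u s r - g s) + fun s => w s r - k s := by
    funext s
    simp only [Pi.add_apply]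
    ring
  have hu' : AEStronglyMeasurable (fun s => u s r - g s)
      (volume.restrict (Set.Ioc 0 F.L)) := (mu r).aestronglyMeasurable.sub lu.aestronglyMeasurable
  have hw' : AEStronglyMeasurable (fun s => w s r - k s)
      (volume.restrict (Set.Ioc 0 F.L)) := (mw r).aestronglyMeasurable.sub lw.aestronglyMeasurable
  rw [key]
  exact eLpNorm_add_le hu' hw' (by norm_num)

lemma hasTrace_const_mul {F : FrenetFrame γ} {side : Filter ℝ} {u : ℝ → ℝ → ℂ} {g : ℝ → ℂ}
    (c : ℂ) (hu : F.HasTrace side u g) :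
    F.HasTrace side (fun s r => c * u s r) (fun s => c * g s) := by
  refine ⟨fun s => by simp only [hu.1 s], hu.2.1.const_mul c, ?_⟩
  have h := ENNReal.Tendsto.const_mul (a := ‖c‖ₑ) hu.2.2 (Or.inr enorm_ne_top)
  rw [mul_zero] at h
  refine h.congr fun r => ?_
  rw [← eLpNorm_const_smul]
  congr 1
  funext s
  simp only [Pi.smul_apply, smul_eq_mul]
  ring

lemma contDiff_partialDeriv {O : Set Plane} {φ : Plane → ℝ} (h : IsTest O φ) (i : Fin 2) :
    ContDiff ℝ ∞ (partialDeriv i φ) :=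
  (h.smooth.fderiv_right (m := ∞) (by simp)).clm_apply contDiff_const

lemma isTest_partialDeriv {O : Set Plane} {φ : Plane → ℝ} (h : IsTest O φ) (i : Fin 2) :
    IsTest O (partialDeriv i φ) := by
  have hs : tsupport (partialDeriv i φ) ⊆ tsupport φ := by
    refine closure_minimal ?_ (isClosed_tsupport φ)
    intro x hx
    have : fderiv ℝ φ x ≠ 0 := fun h0 => hx (by simp [partialDeriv, h0])
    exact support_fderiv_subset ℝ this
  exact ⟨contDiff_partialDeriv h i, h.compact.of_isClosed_subset (isClosed_tsupport _) hs, hs.trans h.supp⟩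

end SchrodingerCurve

namespace SchrodingerCurve

variable {γ : Set Plane}

lemma two_le_infty : (2 : WithTop ℕ∞) ≤ ∞ :=
  WithTop.coe_le_coe.2 (le_top : (2 : ℕ∞) ≤ ⊤)

lemma laplacian_eq {φ : Plane → ℝ} (h : ContDiff ℝ ∞ φ) (x : Plane) :
    (Δ φ) x = ∑ i, partialDeriv i (partialDeriv i φ) x := by
  have hd : DifferentiableAt ℝ (fderiv ℝ φ) x :=
    ((h.fderiv_right (m := ∞) (by simp)).differentiable (by simp)) x
  rw [InnerProductSpace.laplacian_eq_iteratedFDeriv_orthonormalBasis φ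
    (EuclideanSpace.basisFun (Fin 2) ℝ)]
  refine Finset.sum_congr rfl fun i _ => ?_
  have hp : partialDeriv i φ = fun y => fderiv ℝ φ y (EuclideanSpace.single i 1) := rfl
  rw [iteratedFDeriv_two_apply, partialDeriv, hp,
    fderiv_clm_apply hd (differentiableAt_const _)]
  simp

lemma isTest_zero_laplacian {O : Set Plane} {φ : Plane → ℝ} (h : IsTest O φ) :
    Continuous (Δ φ) ∧ HasCompactSupport (Δ φ) := by
  have e : Δ φ = fun x => ∑ i, partialDeriv i (partialDeriv i φ) x := funext (laplacian_eq h.smooth)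
  rw [e]
  have h2 : ∀ i, IsTest O (partialDeriv i (partialDeriv i φ)) :=
    fun i => isTest_partialDeriv (isTest_partialDeriv h i) i
  refine ⟨continuous_finsetSum _ fun i _ => (h2 i).smooth.continuous, ?_⟩
  simp only [Fin.sum_univ_two]
  exact (h2 0).compact.add (h2 1).compact

lemma memLp_locallyIntegrable {f : Plane → ℂ} (hf : MemLp f 2 volume) :
    LocallyIntegrable f volume := hf.locallyIntegrable (by norm_num)

lemma integrable_lap {O : Set Plane} {φ : Plane → ℝ} (h : IsTest O φ) {f : Plane → ℂ}
    (hf : LocallyIntegrable f volume) : Integrable (fun x => (Δ φ) x • f x) :=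
  hf.integrable_smul_left_of_hasCompactSupport (isTest_zero_laplacian h).1 (isTest_zero_laplacian h).2

lemma integrable_pot (B : BackgroundPotential γ) {O : Set Plane} {φ : Plane → ℝ} (h : IsTest O φ)
    {f : Plane → ℂ} (hf : LocallyIntegrable f volume) :
    Integrable (fun x => (B.W x * φ x) • f x) := by
  obtain ⟨C, hC⟩ := B.locallyBounded (tsupport φ) h.compact
  have hi : Integrable (fun x => φ x • f x) :=
    hf.integrable_smul_left_of_hasCompactSupport h.smooth.continuous h.compact
  refine (hi.norm.const_mul C).mono' ?_ ?_
  · exact (B.aemeasurable.aestronglyMeasurable.mul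
      h.smooth.continuous.aestronglyMeasurable).smul hf.aestronglyMeasurable
  · filter_upwards [hC] with x hx
    rw [norm_smul, norm_mul, norm_smul, mul_assoc]
    by_cases hxs : x ∈ tsupport φ
    · exact mul_le_mul_of_nonneg_right (hx hxs) (by positivity)
    · rw [image_eq_zero_of_notMem_tsupport hxs]; simp

lemma integrable_action (B : BackgroundPotential γ) {O : Set Plane} {φ : Plane → ℝ}
    (h : IsTest O φ) {f : Plane → ℂ} (hf : LocallyIntegrable f volume) :
    Integrable (fun x => (-(Δ φ) x + B.W x * φ x) • f x) := by
  have := (integrable_lap h hf).neg.add (integrable_pot B h hf)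
  refine this.congr (Eventually.of_forall fun x => ?_)
  simp only [Pi.add_apply, Pi.neg_apply]
  rw [add_smul, neg_smul]

lemma integrable_test {O : Set Plane} {φ : Plane → ℝ}
    (h : IsTest O φ) {f : Plane → ℂ} (hf : LocallyIntegrable f volume) :
    Integrable (fun x => φ x • f x) :=
  hf.integrable_smul_left_of_hasCompactSupport h.smooth.continuous h.compact

lemma integrable_testOn {O : Set Plane} {φ : Plane → ℝ}
    (h : IsTest O φ) {f : Plane → ℂ} (hf : LocallyIntegrableOn f O) :
    Integrable (fun x => φ x • f x) := by
  have hK : IntegrableOn f (tsupport φ) := hf.integrableOn_compact_subset h.supp h.compact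
  have h1 : IntegrableOn (fun x => φ x • f x) (tsupport φ) :=
    hK.continuousOn_smul h.smooth.continuous.continuousOn h.compact
  refine (integrableOn_iff_integrable_of_support_subset ?_).1 h1
  intro x hx
  by_contra hn
  exact hx (by simp [image_eq_zero_of_notMem_tsupport hn])

lemma isWeakAction_add (B : BackgroundPotential γ) {O : Set Plane} {f₁ f₂ g₁ g₂ f g : L2Plane}
    (h₁ : IsWeakAction B.W O f₁ g₁) (h₂ : IsWeakAction B.W O f₂ g₂) (hf : f = f₁ + f₂)
    (hg : g = g₁ + g₂) : IsWeakAction B.W O f g := by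
  intro φ hφ
  subst hf hg
  have L : ∀ f : L2Plane, LocallyIntegrable f volume :=
    fun f => memLp_locallyIntegrable (Lp.memLp f)
  calc _ = ∫ x, ((-(Δ φ) x + B.W x * φ x) • f₁ x + (-(Δ φ) x + B.W x * φ x) • f₂ x) := by
        refine integral_congr_ae ?_
        filter_upwards [Lp.coeFn_add f₁ f₂] with x hx
        rw [hx, Pi.add_apply, smul_add]
    _ = ∫ x, (φ x • g₁ x + φ x • g₂ x) := by
        rw [integral_add (integrable_action B hφ (L f₁)) (integrable_action B hφ (L f₂)),
          integral_add (integrable_test hφ (L g₁)) (integrable_test hφ (L g₂)), h₁ φ hφ, h₂ φ hφ]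
    _ = _ := by
        refine integral_congr_ae ?_
        filter_upwards [Lp.coeFn_add g₁ g₂] with x hx
        rw [hx, Pi.add_apply, smul_add]

lemma isWeakAction_smul (B : BackgroundPotential γ) {O : Set Plane} {f g : L2Plane} (c : ℂ)
    (h : IsWeakAction B.W O f g) :
    IsWeakAction B.W O (c • f : L2Plane) (c • g : L2Plane) := by
  intro φ hφ
  calc _ = ∫ x, c • ((-(Δ φ) x + B.W x * φ x) • f x) := by
        refine integral_congr_ae ?_
        filter_upwards [Lp.coeFn_smul c f] with x hx
        rw [hx, Pi.smul_apply, smul_comm]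
    _ = ∫ x, c • (φ x • g x) := by rw [integral_smul, integral_smul, h φ hφ]
    _ = _ := by
        refine integral_congr_ae ?_
        filter_upwards [Lp.coeFn_smul c g] with x hx
        rw [hx, Pi.smul_apply, smul_comm]

lemma hasWeakPartial_add {O : Set Plane} {i : Fin 2} {f₁ f₂ g₁ g₂ : Plane → ℂ}
    (h₁ : HasWeakPartial O i f₁ g₁) (h₂ : HasWeakPartial O i f₂ g₂) :
    HasWeakPartial O i (f₁ + f₂) (g₁ + g₂) := by
  refine ⟨h₁.1.add h₂.1, h₁.2.add h₂.2, fun φ hφ => ?_⟩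
  have hp := isTest_partialDeriv hφ i
  simp only [Pi.add_apply, smul_add]
  rw [integral_add (integrable_testOn hp h₁.1) (integrable_testOn hp h₂.1),
    integral_add (integrable_testOn hφ h₁.2) (integrable_testOn hφ h₂.2), h₁.3 φ hφ, h₂.3 φ hφ,
    neg_add]

lemma hasWeakPartial_smul {O : Set Plane} {i : Fin 2} {f g : Plane → ℂ} (c : ℂ)
    (h : HasWeakPartial O i f g) : HasWeakPartial O i (c • f) (c • g) := by
  refine ⟨h.1.smul c, h.2.smul c, fun φ hφ => ?_⟩
  have e : ∀ (a : ℝ) (z : ℂ), a • (c • z) = c • (a • z) := fun a z => smul_comm _ _ _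
  simp only [Pi.smul_apply, e]
  rw [integral_smul, integral_smul, h.3 φ hφ, smul_neg]

lemma hasWeakPartial_congr {O : Set Plane} {i : Fin 2} {f f' g : Plane → ℂ}
    (h : HasWeakPartial O i f g) (e : f =ᵐ[volume] f') : HasWeakPartial O i f' g := by
  refine ⟨fun x hx => (h.1 x hx).congr e, h.2, fun φ hφ => ?_⟩
  rw [← h.3 φ hφ]
  refine integral_congr_ae ?_
  filter_upwards [e] with x hx
  rw [hx]

lemma memW22_add {O : Set Plane} {f₁ f₂ f : Plane → ℂ} (h₁ : MemW22 O f₁) (h₂ : MemW22 O f₂)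
    (e : f₁ + f₂ =ᵐ[volume] f) : MemW22 O f := by
  obtain ⟨m₁, G₁, H₁, a₁, b₁, c₁, d₁⟩ := h₁
  obtain ⟨m₂, G₂, H₂, a₂, b₂, c₂, d₂⟩ := h₂
  exact ⟨(memLp_congr_ae (ae_restrict_of_ae e)).1 (m₁.add m₂), fun i => G₁ i + G₂ i,
    fun i j => H₁ i j + H₂ i j, fun i => (a₁ i).add (a₂ i), fun i j => (b₁ i j).add (b₂ i j),
    fun i => hasWeakPartial_congr (hasWeakPartial_add (c₁ i) (c₂ i)) e,
    fun i j => hasWeakPartial_add (d₁ i j) (d₂ i j)⟩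

lemma memW22_smul {O : Set Plane} {f f' : Plane → ℂ} (c : ℂ) (h : MemW22 O f)
    (e : c • f =ᵐ[volume] f') : MemW22 O f' := by
  obtain ⟨m₁, G₁, H₁, a₁, b₁, c₁, d₁⟩ := h
  exact ⟨(memLp_congr_ae (ae_restrict_of_ae e)).1 (m₁.const_smul c), fun i => c • G₁ i,
    fun i j => c • H₁ i j, fun i => (a₁ i).const_smul c, fun i j => (b₁ i j).const_smul c,
    fun i => hasWeakPartial_congr (hasWeakPartial_smul c (c₁ i)) e,
    fun i j => hasWeakPartial_smul c (d₁ i j)⟩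

lemma memCalW_add (B : BackgroundPotential γ) {v w : L2Plane} (hv : MemCalW γ B.W v)
    (hw : MemCalW γ B.W w) : MemCalW γ B.W (v + w) := by
  obtain ⟨a, f, ⟨g, hg⟩, b⟩ := hv
  obtain ⟨a', f', ⟨g', hg'⟩, b'⟩ := hw
  refine ⟨memW22_add a a' (Lp.coeFn_add v w).symm, f + f',
    ⟨g + g', isWeakAction_add B hg hg' rfl rfl⟩, ?_⟩
  filter_upwards [b, b', Lp.coeFn_add v w, Lp.coeFn_add f f'] with x h1 h2 h3 h4 hx
  rw [h3, h4, Pi.add_apply, Pi.add_apply, h1 hx, h2 hx]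

lemma memCalW_smul (B : BackgroundPotential γ) {v : L2Plane} (c : ℂ) (hv : MemCalW γ B.W v) :
    MemCalW γ B.W (c • v) := by
  obtain ⟨a, f, ⟨g, hg⟩, b⟩ := hv
  refine ⟨memW22_smul c a (Lp.coeFn_smul c v).symm, c • f, ⟨c • g, isWeakAction_smul B c hg⟩, ?_⟩
  filter_upwards [b, Lp.coeFn_smul c v, Lp.coeFn_smul c f] with x h1 h3 h4 hx
  rw [h3, h4, Pi.smul_apply, Pi.smul_apply, h1 hx]

lemma measurable_slice (F : FrenetFrame γ) {u : Plane → ℂ} (hu : Measurable u) (r : ℝ) :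
    Measurable fun s => u (F.point s r) := hu.comp (continuous_point F r).measurable

lemma measurable_normal (F : FrenetFrame γ) {G : Fin 2 → Plane → ℂ} (hG : ∀ i, Measurable (G i))
    (r : ℝ) : Measurable fun s => F.normalDeriv G s r := by
  unfold FrenetFrame.normalDeriv
  exact Finset.measurable_sum _ fun i _ =>
    (Complex.measurable_ofReal.comp (continuous_nu F i).measurable).mul (measurable_slice F (hG i) r)

lemma satisfies_add {F : FrenetFrame γ} {θ : ℝ} {μ : ℝ → ℝ} {v w : L2Plane}
    (hv : SatisfiesTransmission F θ μ v) (hw : SatisfiesTransmission F θ μ w) :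
    SatisfiesTransmission F θ μ (v + w) := by
  obtain ⟨u, G, vp, vm, dp, dm, a1, a2, a3, a4, a5, a6, a7, a8, a9⟩ := hv
  obtain ⟨u', G', vp', vm', dp', dm', b1, b2, b3, b4, b5, b6, b7, b8, b9⟩ := hw
  have en : F.normalDeriv (fun i => G i + G' i)
      = fun s r => F.normalDeriv G s r + F.normalDeriv G' s r := by
    funext s r
    simp only [FrenetFrame.normalDeriv, Pi.add_apply, mul_add, Finset.sum_add_distrib]
  refine ⟨u + u', fun i => G i + G' i, vp + vp', vm + vm', dp + dp', dm + dm', a1.add b1,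
    fun i => (a2 i).add (b2 i), ?_, fun i => hasWeakPartial_add (a4 i) (b4 i),
    hasTrace_add a5 b5 (measurable_slice F a1) (measurable_slice F b1),
    hasTrace_add a6 b6 (measurable_slice F a1) (measurable_slice F b1), ?_, ?_, ?_⟩
  · filter_upwards [a3, b3, Lp.coeFn_add v w] with x h1 h2 h3
    rw [h3, Pi.add_apply, Pi.add_apply, h1, h2]
  · unfold FrenetFrame.HasNormalTracePlus
    rw [en]
    exact hasTrace_add a7 b7 (measurable_normal F a2) (measurable_normal F b2)
  · unfold FrenetFrame.HasNormalTraceMinus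
    rw [en]
    exact hasTrace_add a8 b8 (measurable_normal F a2) (measurable_normal F b2)
  · filter_upwards [a9, b9] with s h1 h2
    refine ⟨?_, ?_⟩
    · simp only [Pi.add_apply, h1.1, h2.1]; ring
    · simp only [Pi.add_apply]
      linear_combination h1.2 + h2.2

lemma satisfies_smul {F : FrenetFrame γ} {θ : ℝ} {μ : ℝ → ℝ} {v : L2Plane} (c : ℂ)
    (hv : SatisfiesTransmission F θ μ v) : SatisfiesTransmission F θ μ (c • v) := by
  obtain ⟨u, G, vp, vm, dp, dm, a1, a2, a3, a4, a5, a6, a7, a8, a9⟩ := hv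
  have en : F.normalDeriv (fun i => c • G i) = fun s r => c * F.normalDeriv G s r := by
    funext s r
    simp only [FrenetFrame.normalDeriv, Pi.smul_apply, smul_eq_mul, Finset.mul_sum]
    exact Finset.sum_congr rfl fun i _ => by ring
  refine ⟨c • u, fun i => c • G i, fun s => c * vp s, fun s => c * vm s, fun s => c * dp s,
    fun s => c * dm s, a1.const_smul c,
    fun i => (a2 i).const_smul c, ?_, fun i => hasWeakPartial_smul c (a4 i),
    hasTrace_const_mul c a5, hasTrace_const_mul c a6, ?_, ?_, ?_⟩
  · filter_upwards [a3, Lp.coeFn_smul c v] with x h1 h3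
    rw [h3, Pi.smul_apply, Pi.smul_apply, h1]
  · unfold FrenetFrame.HasNormalTracePlus
    rw [en]
    exact hasTrace_const_mul c a7
  · unfold FrenetFrame.HasNormalTraceMinus
    rw [en]
    exact hasTrace_const_mul c a8
  · filter_upwards [a9] with s h1
    refine ⟨?_, ?_⟩
    · rw [h1.1]; ring
    · linear_combination c * h1.2

lemma hasWeakPartial_zero (O : Set Plane) (i : Fin 2) :
    HasWeakPartial O i (0 : Plane → ℂ) 0 :=
  ⟨(locallyIntegrable_zero (X := Plane) (μ := volume)).locallyIntegrableOn O,
    (locallyIntegrable_zero (X := Plane) (μ := volume)).locallyIntegrableOn O, fun φ _ => by simp⟩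

lemma memCalW_zero (W : Plane → ℝ) : MemCalW γ W 0 := by
  have e : (0 : Plane → ℂ) =ᵐ[volume] ((0 : L2Plane) : Plane → ℂ) := (Lp.coeFn_zero ℂ 2 _).symm
  refine ⟨⟨(memLp_congr_ae (ae_restrict_of_ae e)).1 MemLp.zero, fun _ => 0, fun _ _ => 0,
    fun _ => MemLp.zero, fun _ _ => MemLp.zero,
    fun i => hasWeakPartial_congr (hasWeakPartial_zero _ i) e,
    fun _ j => hasWeakPartial_zero _ j⟩, 0, ⟨0, fun φ _ => ?_⟩, Eventually.of_forall fun _ _ => rfl⟩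
  rw [integral_eq_zero_of_ae, integral_eq_zero_of_ae]
  · filter_upwards [e] with x hx
    rw [← hx]; simp
  · filter_upwards [e] with x hx
    rw [← hx]; simp

lemma hasTrace_zero (F : FrenetFrame γ) (side : Filter ℝ) :
    F.HasTrace side (fun _ _ => 0) (fun _ => 0) := by
  refine ⟨fun _ => rfl, MemLp.zero, ?_⟩
  simp only [sub_self]
  have e : (fun _ : ℝ => eLpNorm (fun _ : ℝ => (0 : ℂ)) 2 (volume.restrict (Set.Ioc 0 F.L)))
      = fun _ => 0 := by
    funext r
    exact eLpNorm_zero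
  rw [e]
  exact tendsto_const_nhds

lemma satisfies_zero (F : FrenetFrame γ) (θ : ℝ) (μ : ℝ → ℝ) :
    SatisfiesTransmission F θ μ 0 := by
  have en : F.normalDeriv (fun _ _ => 0) = fun _ _ => 0 := by
    funext s r
    simp [FrenetFrame.normalDeriv]
  refine ⟨fun _ => 0, fun _ _ => 0, fun _ => 0, fun _ => 0, fun _ => 0, fun _ => 0,
    measurable_const, fun _ => measurable_const, (Lp.coeFn_zero ℂ 2 _).symm,
    fun i => hasWeakPartial_zero _ i, hasTrace_zero F _, hasTrace_zero F _, ?_, ?_,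
    Eventually.of_forall fun s => by simp [TransmissionConditions]⟩
  · unfold FrenetFrame.HasNormalTracePlus
    rw [en]
    exact hasTrace_zero F _
  · unfold FrenetFrame.HasNormalTraceMinus
    rw [en]
    exact hasTrace_zero F _

lemma weakAction_unique (F : FrenetFrame γ) (W : Plane → ℝ) {v f g : L2Plane}
    (h₁ : IsWeakAction W γᶜ v f) (h₂ : IsWeakAction W γᶜ v g) : f = g := by
  have hO : IsOpen γᶜ := (isCompact_curve F).isClosed.isOpen_compl
  have L : ∀ f : L2Plane, LocallyIntegrable f volume :=
    fun f => memLp_locallyIntegrable (Lp.memLp f)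
  have h := hO.ae_eq_zero_of_integral_contDiff_smul_eq_zero (μ := volume)
    (((L f).sub (L g)).locallyIntegrableOn γᶜ) (fun φ h1 h2 h3 => by
      have hφ : IsTest γᶜ φ := ⟨h1, h2, h3⟩
      simp only [Pi.sub_apply, smul_sub]
      rw [integral_sub (integrable_test hφ (L f)) (integrable_test hφ (L g)), ← h₁ φ hφ,
        ← h₂ φ hφ, sub_self])
  have hn : ∀ᵐ x ∂(volume : Measure Plane), x ∈ γᶜ := by
    rw [ae_iff]; simpa using volume_curve F
  refine Lp.ext ?_
  filter_upwards [h, hn] with x h1 h2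
  exact sub_eq_zero.1 (h1 h2)

lemma isOpen_inside (hγ : IsClosed γ) : IsOpen (inside γ) := by
  rw [isOpen_iff_mem_nhds]
  intro x hx
  filter_upwards [(hγ.isOpen_compl.connectedComponentIn (x := x)).mem_nhds
    (mem_connectedComponentIn hx.1)] with y hy
  exact ⟨connectedComponentIn_subset _ _ hy, by rw [← connectedComponentIn_eq hy]; exact hx.2⟩

lemma isOpen_outside (hγ : IsClosed γ) : IsOpen (outside γ) := by
  rw [isOpen_iff_mem_nhds]
  intro x hx
  filter_upwards [(hγ.isOpen_compl.connectedComponentIn (x := x)).mem_nhds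
    (mem_connectedComponentIn hx.1)] with y hy
  exact ⟨connectedComponentIn_subset _ _ hy, by rw [← connectedComponentIn_eq hy]; exact hx.2⟩

lemma bounded_inside (hγ : IsCompact γ) : ∃ R : ℝ, inside γ ⊆ Metric.closedBall 0 R := by
  obtain ⟨R, hR⟩ := hγ.isBounded.subset_closedBall (0 : Plane)
  refine ⟨max R 0, fun x hx => ?_⟩
  by_contra hn
  have hn' : max R 0 < ‖x‖ := by simpa using hn
  have hx0 : 0 < ‖x‖ := lt_of_le_of_lt (le_max_right _ _) hn'
  have hxR : R < ‖x‖ := lt_of_le_of_lt (le_max_left _ _) hn'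
  let ray : Set Plane := (fun t : ℝ => t • x) '' Set.Ici 1
  have hc : IsPreconnected ray :=
    isPreconnected_Ici.image _ (continuous_id.smul continuous_const).continuousOn
  have hsub : ray ⊆ γᶜ := by
    rintro _ ⟨t, ht, rfl⟩ hmem
    have := hR hmem
    rw [mem_closedBall_zero_iff, norm_smul, Real.norm_of_nonneg (by linarith [Set.mem_Ici.1 ht])]
      at this
    nlinarith [Set.mem_Ici.1 ht]
  have hray : ray ⊆ connectedComponentIn γᶜ x :=
    hc.subset_connectedComponentIn ⟨1, Set.mem_Ici.2 le_rfl, one_smul _ _⟩ hsub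
  obtain ⟨M, hM⟩ := (hx.2.subset hray).exists_norm_le
  have h1 : (1 : ℝ) ≤ |M| / ‖x‖ + 1 := by
    have : 0 ≤ |M| / ‖x‖ := by positivity
    linarith
  have := hM _ ⟨|M| / ‖x‖ + 1, h1, rfl⟩
  simp only at this
  rw [norm_smul, Real.norm_of_nonneg (by linarith), add_mul, div_mul_cancel₀ _ hx0.ne'] at this
  linarith [le_abs_self M]

/-- Cutting a test function of `ℝ² ∖ γ` off to one of the two sides of `γ`. -/
lemma isTest_indicator {A A' : Set Plane} (hA : IsOpen A) (hA' : IsOpen A') (hd : Disjoint A A')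
    (hc : A ∪ A' = γᶜ) {φ : Plane → ℝ} (h : IsTest γᶜ φ) : IsTest A (A.indicator φ) := by
  have hs : tsupport (A.indicator φ) ⊆ tsupport φ ∩ A := by
    have e : tsupport φ ∩ A = tsupport φ ∩ A'ᶜ := by
      ext x
      refine and_congr_right fun hx => ?_
      have hx' : x ∈ A ∪ A' := hc ▸ h.supp hx
      exact ⟨fun h1 h2 => Set.disjoint_left.1 hd h1 h2, fun h1 => hx'.resolve_right h1⟩
    refine closure_minimal ?_ (e ▸ (isClosed_tsupport φ).inter hA'.isClosed_compl)
    intro x hx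
    rw [Set.support_indicator] at hx
    exact ⟨subset_tsupport φ hx.2, hx.1⟩
  refine ⟨contDiff_iff_contDiffAt.2 fun x => ?_,
    h.compact.of_isClosed_subset (isClosed_tsupport _) (hs.trans Set.inter_subset_left),
    hs.trans Set.inter_subset_right⟩
  by_cases hx : x ∈ A
  · refine h.smooth.contDiffAt.congr_of_eventuallyEq ?_
    filter_upwards [hA.mem_nhds hx] with y hy
    exact Set.indicator_of_mem hy φ
  · have hx' : x ∉ tsupport (A.indicator φ) := fun hm => hx (hs hm).2
    refine (contDiffAt_const (c := (0 : ℝ))).congr_of_eventuallyEq ?_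
    filter_upwards [(isClosed_tsupport (A.indicator φ)).isOpen_compl.mem_nhds hx'] with y hy
    exact image_eq_zero_of_notMem_tsupport hy

lemma laplacian_zero_off {O : Set Plane} {φ : Plane → ℝ} (h : IsTest O φ) {x : Plane}
    (hx : x ∉ O) : (Δ φ) x = 0 := by
  rw [laplacian_eq h.smooth]
  refine Finset.sum_eq_zero fun i _ => image_eq_zero_of_notMem_tsupport fun hm => hx ?_
  exact (isTest_partialDeriv (isTest_partialDeriv h i) i).supp hm

/-- For `v ∈ 𝒲`, the distribution `-Δ v + W v` in `ℝ² ∖ γ` is a function of class `L²`. -/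
lemma exists_action (F : FrenetFrame γ) (B : BackgroundPotential γ) {v : L2Plane}
    (hv : MemCalW γ B.W v) : ∃ f : L2Plane, IsWeakAction B.W γᶜ v f := by
  obtain ⟨⟨hm, G, H, hG, hH, hGw, hHw⟩, f₀, ⟨g₀, hg₀⟩, hout⟩ := hv
  have hK := isCompact_curve F
  have oi := isOpen_inside hK.isClosed
  have oo := isOpen_outside hK.isClosed
  have hd : Disjoint (inside γ) (outside γ) :=
    Set.disjoint_left.2 fun x h1 h2 => h2.2 h1.2
  have hc : inside γ ∪ outside γ = γᶜ := by
    ext x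
    exact ⟨fun h => h.elim And.left And.left, fun h => (em _).imp (And.intro h) (And.intro h)⟩
  obtain ⟨R, hR⟩ := bounded_inside hK
  obtain ⟨C, hC⟩ := B.locallyBounded _ (isCompact_closedBall (0 : Plane) R)
  let A : Plane → ℂ := fun x => -(H 0 0 x + H 1 1 x) + B.W x • v x
  have hA : MemLp A 2 (volume.restrict (inside γ)) := by
    refine ((hH 0 0).add (hH 1 1)).neg.add ?_
    refine hm.of_le_mul (c := C) ?_ ?_
    · exact B.aemeasurable.aestronglyMeasurable.restrict.smul hm.aestronglyMeasurable
    · refine (ae_restrict_iff' oi.measurableSet).2 ?_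
      filter_upwards [hC] with x hx hxi
      rw [norm_smul]
      exact mul_le_mul_of_nonneg_right (hx (hR hxi)) (norm_nonneg _)
  let a : Plane → ℂ := (inside γ).indicator A + (outside γ).indicator g₀
  have ha : MemLp a 2 volume :=
    ((memLp_indicator_iff_restrict oi.measurableSet).2 hA).add
      ((Lp.memLp g₀).indicator oo.measurableSet)
  have L : ∀ f : L2Plane, LocallyIntegrable f volume :=
    fun f => memLp_locallyIntegrable (Lp.memLp f)
  have La := memLp_locallyIntegrable ha
  refine ⟨ha.toLp a, fun φ hφ => ?_⟩
  have h1 : IsTest (inside γ) ((inside γ).indicator φ) := isTest_indicator oi oo hd hc hφ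
  have h2 : IsTest (outside γ) ((outside γ).indicator φ) :=
    isTest_indicator oo oi hd.symm (by rw [Set.union_comm, hc]) hφ
  set φ₁ := (inside γ).indicator φ with hφ₁
  set φ₂ := (outside γ).indicator φ with hφ₂
  have hsum : φ = φ₁ + φ₂ := by
    funext x
    by_cases hx : x ∈ γᶜ
    · rw [← hc] at hx
      rcases hx with hx | hx
      · have : x ∉ outside γ := Set.disjoint_left.1 hd hx
        simp [hφ₁, hφ₂, hx, this]
      · have : x ∉ inside γ := Set.disjoint_right.1 hd hx
        simp [hφ₁, hφ₂, hx, this]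
    · have h0 : φ x = 0 := image_eq_zero_of_notMem_tsupport fun hm => hx (hφ.supp hm)
      have i1 : x ∉ inside γ := fun h => hx h.1
      have i2 : x ∉ outside γ := fun h => hx h.1
      simp [hφ₁, hφ₂, i1, i2, h0]
  have hlap : ∀ x, (Δ φ) x = (Δ φ₁) x + (Δ φ₂) x := by
    intro x
    rw [hsum, ContDiffAt.laplacian_add
      (h1.smooth.of_le two_le_infty).contDiffAt (h2.smooth.of_le two_le_infty).contDiffAt]
  have e1 : ∫ x, (-(Δ φ₁) x + B.W x * φ₁ x) • v x = ∫ x, φ₁ x • a x := by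
    have t : ∀ i, ∫ x, partialDeriv i (partialDeriv i φ₁) x • v x = ∫ x, φ₁ x • H i i x := by
      intro i
      rw [(hGw i).3 _ (isTest_partialDeriv h1 i), (hHw i i).3 _ h1, neg_neg]
    have it : ∀ i, Integrable fun x => partialDeriv i (partialDeriv i φ₁) x • v x := fun i =>
      integrable_test (isTest_partialDeriv (isTest_partialDeriv h1 i) i) (L v)
    have iH : ∀ i, Integrable fun x => φ₁ x • H i i x := fun i => integrable_testOn h1 (hHw i i).2
    have iW := integrable_pot B h1 (L v)
    calc _ = ∫ x, (-(partialDeriv 0 (partialDeriv 0 φ₁) x • v x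
              + partialDeriv 1 (partialDeriv 1 φ₁) x • v x) + (B.W x * φ₁ x) • v x) := by
          refine integral_congr_ae (Eventually.of_forall fun x => ?_)
          simp only [laplacian_eq h1.smooth, Fin.sum_univ_two, add_smul, neg_smul]
      _ = ∫ x, (-(φ₁ x • H 0 0 x + φ₁ x • H 1 1 x) + (B.W x * φ₁ x) • v x) := by
          have n1 : Integrable fun x => -(partialDeriv 0 (partialDeriv 0 φ₁) x • v x
              + partialDeriv 1 (partialDeriv 1 φ₁) x • v x) := ((it 0).add (it 1)).neg
          have n2 : Integrable fun x => -(φ₁ x • H 0 0 x + φ₁ x • H 1 1 x) :=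
            ((iH 0).add (iH 1)).neg
          rw [integral_add n1 iW, integral_add n2 iW,
            integral_neg, integral_neg, integral_add (it 0) (it 1), integral_add (iH 0) (iH 1),
            t 0, t 1]
      _ = _ := by
          refine integral_congr_ae (Eventually.of_forall fun x => ?_)
          by_cases hx : x ∈ inside γ
          · have hx' : x ∉ outside γ := Set.disjoint_left.1 hd hx
            simp only [a, A, Pi.add_apply, Set.indicator_of_mem hx, Set.indicator_of_notMem hx',
              add_zero, smul_add, smul_neg, smul_smul, mul_comm (B.W x)]
          · have : φ₁ x = 0 := Set.indicator_of_notMem hx φ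
            simp [this]
  have e2 : ∫ x, (-(Δ φ₂) x + B.W x * φ₂ x) • v x = ∫ x, φ₂ x • a x := by
    have h2u : IsTest Set.univ φ₂ := ⟨h2.1, h2.2, Set.subset_univ _⟩
    calc _ = ∫ x, (-(Δ φ₂) x + B.W x * φ₂ x) • f₀ x := by
          refine integral_congr_ae ?_
          filter_upwards [hout] with x hx
          by_cases hxo : x ∈ outside γ
          · rw [hx hxo]
          · have : φ₂ x = 0 := Set.indicator_of_notMem hxo φ
            simp [this, laplacian_zero_off h2 hxo]
      _ = ∫ x, φ₂ x • g₀ x := hg₀ φ₂ h2u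
      _ = _ := by
          refine integral_congr_ae (Eventually.of_forall fun x => ?_)
          by_cases hx : x ∈ outside γ
          · have hx' : x ∉ inside γ := Set.disjoint_right.1 hd hx
            simp only [a, Pi.add_apply, Set.indicator_of_mem hx, Set.indicator_of_notMem hx',
              zero_add]
          · have : φ₂ x = 0 := Set.indicator_of_notMem hx φ
            simp [this]
  calc _ = ∫ x, ((-(Δ φ₁) x + B.W x * φ₁ x) • v x + (-(Δ φ₂) x + B.W x * φ₂ x) • v x) := by
        refine integral_congr_ae (Eventually.of_forall fun x => ?_)
        have hs : φ x = φ₁ x + φ₂ x := congrFun hsum x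
        simp only [hlap x, hs, ← add_smul]
        congr 1
        ring
    _ = ∫ x, (φ₁ x • a x + φ₂ x • a x) := by
        rw [integral_add (integrable_action B h1 (L v)) (integrable_action B h2 (L v)), e1, e2,
          integral_add (integrable_test h1 La) (integrable_test h2 La)]
    _ = _ := by
        refine integral_congr_ae ?_
        filter_upwards [ha.coeFn_toLp] with x hx
        have hs : φ x = φ₁ x + φ₂ x := congrFun hsum x
        rw [hx, hs, add_smul]

end SchrodingerCurve

/-- `dom ℋ`: the elements of `𝒲` that satisfy the transmission conditions. -/
def limitDomain {γ : Set Plane} (F : FrenetFrame γ) (P : Profile F.L) (h : ℝ → ℝ)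
    (B : BackgroundPotential γ) : Submodule ℂ L2Plane where
  carrier := {v | MemCalW γ B.W v ∧ SatisfiesTransmission F (thetaOf h) (muOf P.U h) v}
  add_mem' := fun ha hb =>
    ⟨SchrodingerCurve.memCalW_add B ha.1 hb.1, SchrodingerCurve.satisfies_add ha.2 hb.2⟩
  smul_mem' := fun c _ ha =>
    ⟨SchrodingerCurve.memCalW_smul B c ha.1, SchrodingerCurve.satisfies_smul c ha.2⟩
  zero_mem' := ⟨SchrodingerCurve.memCalW_zero B.W, SchrodingerCurve.satisfies_zero F _ _⟩

/-- The limit operator `ℋ = -Δ + W` in `L²(ℝ²)` with domain `dom ℋ`: `ℋ v` is the element of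
`L²(ℝ²)` which equals `-Δ v + W v` in `ℝ² ∖ γ`. -/
def limitOperator {γ : Set Plane} (F : FrenetFrame γ) (P : Profile F.L) (h : ℝ → ℝ)
    (B : BackgroundPotential γ) : L2Plane →ₗ.[ℂ] L2Plane where
  domain := limitDomain F P h B
  toFun :=
    { toFun := fun v => (SchrodingerCurve.exists_action F B v.2.1).choose
      map_add' := fun v w => SchrodingerCurve.weakAction_unique F B.W
        (SchrodingerCurve.exists_action F B (v + w).2.1).choose_spec
        (SchrodingerCurve.isWeakAction_add B (SchrodingerCurve.exists_action F B v.2.1).choose_spec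
          (SchrodingerCurve.exists_action F B w.2.1).choose_spec rfl rfl)
      map_smul' := fun c v => SchrodingerCurve.weakAction_unique F B.W
        (SchrodingerCurve.exists_action F B (c • v).2.1).choose_spec
        (SchrodingerCurve.isWeakAction_smul B c
          (SchrodingerCurve.exists_action F B v.2.1).choose_spec) }

lemma limitOperator_spec {γ : Set Plane} (F : FrenetFrame γ) (P : Profile F.L) (h : ℝ → ℝ)
    (B : BackgroundPotential γ) (v : (limitOperator F P h B).domain) :
    IsWeakAction B.W γᶜ (v : L2Plane) (limitOperator F P h B v) :=
  (SchrodingerCurve.exists_action F B v.2.1).choose_spec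

end

/-!
Two facts reduce the claim to a calculation.

The first one is geometric: two unit-speed parametrizations of `γ` differ by a substitution
`s ↦ σ s + c` with `σ = ±1`, and have the same period
(`FrenetFrame.exists_isReparametrization`).  Indeed, each of them embeds a circle into the plane, so
that the transition map between the circles lifts to a continuous function `φ : ℝ → ℝ` with
`α₁ = α ∘ φ` for the new parametrization `α₁`.  As `α` is an immersion, `φ` is differentiable, and
its derivative has modulus one because both speeds are one; by continuity the derivative is
constant.  The substitution multiplies `ν` and `κ` by `σ`, and the point with the new coordinates
`(s, r)` has the old coordinates `(σ s + c, σ r)`.  Comparing the leading and the next term of `V_ε`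
as `ε → 0` gives `V₁(n) = V(σ n)` and `U₁(s, n) = U(σ s + c, σ n)` for the new profiles
(`IsPotentialFamily.profile_eq`).

The second one is analytic: the half-bound state is unique up to a factor
(`IsHalfBoundState.exists_smul_eq`).  A bounded solution of `h'' = V h` is constant to the right of
the support of `V`, so that the Cauchy data of any two half-bound states are proportional there.
Since `θ` and `μ` are homogeneous of degree zero in `h`, they depend on the profiles only.

For `σ = 1` the data of the two frames are shifts of each other.  For `σ = -1` one may take
`h₁(r) = h(-r)`, which replaces `θ`, `κ`, `μ` by `θ⁻¹`, `-κ`, `θ⁻² μ`, exchanges the two sides of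
the curve and changes the sign of the normal derivatives; an elementary calculation shows that the
transmission conditions stay the same (`transmissionConditions_reverse_iff`).  The traces are
compatible with the substitution because it preserves Lebesgue measure and takes an interval of
periods to another one.  So the domains coincide, and the action is determined by the element of the
domain, as `-Δ v + W v` is taken in the sense of distributions off `γ`.
-/

/-! ### Arc-length parametrizations of one curve -/

namespace FrenetFrame

variable {γ : Set Plane}

/-- `F'` arises from `F` by the change of the arc-length parameter `s ↦ σ s + c`, where
`σ = 1` (the same orientation) or `σ = -1` (the opposite one). -/
structure IsReparametrization (F F' : FrenetFrame γ) (σ c : ℝ) : Prop where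
  sign : σ = 1 ∨ σ = -1
  length_eq : F'.L = F.L
  α_eq : ∀ s, F'.α s = F.α (σ * s + c)

lemma contDiff_deriv_α (F : FrenetFrame γ) : ContDiff ℝ ∞ (deriv F.α) :=
  (contDiff_infty_iff_deriv.1 F.smooth).2

lemma hasDerivAt_α (F : FrenetFrame γ) (s : ℝ) : HasDerivAt F.α (deriv F.α s) s :=
  (F.smooth.differentiable (by simp) s).hasDerivAt

/-- The circle `ℝ / Lℤ` is embedded in the plane as the curve `γ`. -/
lemma isEmbedding_lift (F : FrenetFrame γ) : IsEmbedding (F.periodic.lift) := by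
  have : Fact (0 < F.L) := ⟨F.L_pos⟩
  have hc : Continuous F.periodic.lift := by
    refine (QuotientAddGroup.isQuotientMap_mk _).continuous_iff.2 ?_
    exact F.smooth.continuous
  refine (hc.isClosedEmbedding ?_).isEmbedding
  intro x y hxy
  have key : ∀ z : AddCircle F.L, ∃ s ∈ Set.Ico 0 F.L, (s : AddCircle F.L) = z := fun z => by
    have h := AddCircle.coe_image_Ico_eq F.L 0
    rw [zero_add] at h
    exact (Set.ext_iff.1 h z).2 (Set.mem_univ z)
  obtain ⟨s, hs, rfl⟩ := key x
  obtain ⟨t, ht, rfl⟩ := key y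
  rw [F.periodic.lift_coe, F.periodic.lift_coe] at hxy
  rw [F.injOn hs ht hxy]

/-- The parameter of one parametrization is a continuous function of the parameter of another:
the lift of a loop in the circle `ℝ / Lℤ` to its covering `ℝ`. -/
lemma exists_continuous_parameter (F F' : FrenetFrame γ) :
    ∃ φ : ℝ → ℝ, Continuous φ ∧ ∀ s, F'.α s = F.α (φ s) := by
  have hmem : ∀ s, ∃ z : AddCircle F.L, F.periodic.lift z = F'.α s := fun s => by
    obtain ⟨t, ht⟩ : F'.α s ∈ Set.range F.α :=
      (F'.range_eq.trans F.range_eq.symm).subset (Set.mem_range_self s)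
    exact ⟨t, by rw [F.periodic.lift_coe, ht]⟩
  choose f hf using hmem
  have hfc : Continuous f := by
    rw [F.isEmbedding_lift.continuous_iff]
    have : F.periodic.lift ∘ f = F'.α := funext hf
    rw [this]
    exact F'.smooth.continuous
  obtain ⟨t, ht⟩ := QuotientAddGroup.mk_surjective (f 0)
  obtain ⟨Φ, ⟨-, h2⟩, -⟩ := (AddCircle.isCoveringMap_coe F.L).existsUnique_continuousMap_lifts
    ⟨f, hfc⟩ 0 t ht
  refine ⟨Φ, Φ.continuous, fun s => ?_⟩
  have h3 : ((Φ s : ℝ) : AddCircle F.L) = f s := congrFun h2 s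
  rw [← hf s, ← h3, F.periodic.lift_coe]

/-- A continuous change of parameter between unit-speed parametrizations is differentiable: near
a parameter value `t`, the projection of `F.α` onto the tangent at `t` is a local coordinate. -/
lemma hasDerivAt_parameter (F F' : FrenetFrame γ) {φ : ℝ → ℝ} (hφ : Continuous φ)
    (h : ∀ s, F'.α s = F.α (φ s)) (s : ℝ) :
    HasDerivAt φ (inner ℝ (deriv F.α (φ s)) (deriv F'.α s)) s := by
  set T := deriv F.α (φ s) with hT
  let p : ℝ → ℝ := fun t => inner ℝ T (F.α t)
  have hp : HasDerivAt p 1 (φ s) := by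
    have := (hasDerivAt_const (φ s) T).inner ℝ (F.hasDerivAt_α (φ s))
    rwa [inner_zero_left, add_zero, ← hT, real_inner_self_eq_norm_sq, hT, F.unit_speed, one_pow]
      at this
  have hq : HasDerivAt (p ∘ φ) (inner ℝ T (deriv F'.α s)) s := by
    have := (hasDerivAt_const s T).inner ℝ (F'.hasDerivAt_α s)
    have e : p ∘ φ = fun t => inner ℝ T (F'.α t) := funext fun t => by simp [p, h]
    rw [e]
    simpa using this
  -- `slope (p ∘ φ) = (dslope p ∘ φ) * slope φ`, where `dslope p` is continuous at `φ s` with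
  -- the value one
  have hd : Tendsto (fun t => dslope p (φ s) (φ t)) (𝓝[≠] s) (𝓝 1) := by
    have h1 : ContinuousAt (dslope p (φ s)) (φ s) :=
      continuousAt_dslope_same.2 hp.differentiableAt
    have h2 := (h1.comp (f := φ) hφ.continuousAt).tendsto.mono_left
      (nhdsWithin_le_nhds (s := {s}ᶜ))
    simpa [Function.comp_def, dslope_same, hp.deriv] using h2
  rw [hasDerivAt_iff_tendsto_slope] at hq ⊢
  have h3 := hq.div hd one_ne_zero
  rw [div_one] at h3
  refine h3.congr' ?_
  filter_upwards [hd.eventually_ne one_ne_zero] with t ht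
  have h4 : (φ t - φ s) * dslope p (φ s) (φ t) = p (φ t) - p (φ s) := by
    have := sub_smul_dslope p (φ s) (φ t)
    simpa using this
  rw [Pi.div_apply, div_eq_iff ht, slope_def_field, slope_def_field, Function.comp, Function.comp,
    ← h4]
  ring

/-- The period of a unit-speed parametrization does not exceed any other positive period, since the
parametrization is injective on `[0, L)`. -/
lemma length_le_of_periodic (F : FrenetFrame γ) {T : ℝ} (hT : 0 < T)
    (h : Function.Periodic F.α T) : F.L ≤ T := by
  by_contra! hlt
  have := F.injOn ⟨le_rfl, F.L_pos⟩ ⟨hT.le, hlt⟩ (by simpa using (h 0).symm)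
  exact hT.ne this

/-- Two unit-speed parametrizations of one curve differ by a shift of the parameter, and possibly by
the orientation. -/
theorem exists_isReparametrization (F F' : FrenetFrame γ) :
    ∃ σ c, IsReparametrization F F' σ c := by
  obtain ⟨φ, hφ, h⟩ := exists_continuous_parameter F F'
  have hd := hasDerivAt_parameter F F' hφ h
  have hsq : ∀ s, deriv φ s ^ 2 = 1 := fun s => by
    have h1 : HasDerivAt F'.α (deriv φ s • deriv F.α (φ s)) s := by
      have h0 : HasDerivAt φ (deriv φ s) s := (hd s).differentiableAt.hasDerivAt
      have := (F.hasDerivAt_α (φ s)).scomp s h0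
      rwa [show F.α ∘ φ = F'.α from funext fun t => (h t).symm] at this
    have h2 := F'.unit_speed s
    rw [h1.deriv, norm_smul, F.unit_speed, mul_one, Real.norm_eq_abs] at h2
    rw [← sq_abs, h2, one_pow]
  have hcont : Continuous (deriv φ) := by
    rw [show deriv φ = _ from funext fun s => (hd s).deriv]
    exact (F.contDiff_deriv_α.continuous.comp hφ).inner F'.contDiff_deriv_α.continuous
  obtain ⟨σ, hσ, hconst⟩ : ∃ σ : ℝ, (σ = 1 ∨ σ = -1) ∧ ∀ s, deriv φ s = σ := by
    rcases isPreconnected_univ.eq_one_or_eq_neg_one_of_sq_eq hcont.continuousOn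
      (fun s _ => hsq s) with h1 | h1
    · exact ⟨1, Or.inl rfl, fun s => h1 (Set.mem_univ s)⟩
    · exact ⟨-1, Or.inr rfl, fun s => h1 (Set.mem_univ s)⟩
  have hlin : ∀ s, φ s = σ * s + φ 0 := by
    have hdiff : Differentiable ℝ fun s => φ s - σ * s := fun s =>
      (hd s).differentiableAt.sub (by fun_prop)
    intro s
    have := is_const_of_deriv_eq_zero hdiff (fun t => by
      have h1 := ((hd t).differentiableAt.hasDerivAt.sub ((hasDerivAt_id t).const_mul σ)).deriv
      rw [show (fun s => φ s - σ * s) = (φ - fun s => σ * id s) from rfl, h1, hconst]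
      ring) s 0
    linarith
  have hα : ∀ s, F'.α s = F.α (σ * s + φ 0) := fun s => by rw [h, hlin]
  have hσσ : σ * σ = 1 := by rcases hσ with rfl | rfl <;> norm_num
  have hα' : ∀ t, F.α t = F'.α (σ * (t - φ 0)) := fun t => by
    rw [hα, ← mul_assoc, hσσ, one_mul, sub_add_cancel]
  refine ⟨σ, φ 0, hσ, le_antisymm ?_ ?_, hα⟩
  · refine F'.length_le_of_periodic F.L_pos fun s => ?_
    rw [hα, hα, mul_add]
    rcases hσ with rfl | rfl
    · rw [← F.periodic (1 * s + φ 0)]; congr 1; ring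
    · rw [← F.periodic (-1 * s + -1 * F.L + φ 0)]; congr 1; ring
  · refine F.length_le_of_periodic F'.L_pos fun s => ?_
    rw [hα', hα' s]
    rcases hσ with rfl | rfl
    · rw [← F'.periodic (1 * (s - φ 0))]; congr 1; ring
    · rw [← F'.periodic (-1 * (s + F'.L - φ 0))]; congr 1; ring

lemma isReparametrization_reverse (F : FrenetFrame γ) : IsReparametrization F F.reverse (-1) 0 :=
  ⟨Or.inr rfl, rfl, fun s => by simp [reverse]⟩

namespace IsReparametrization

variable {F F' : FrenetFrame γ} {σ c : ℝ}

lemma mul_self (h : IsReparametrization F F' σ c) : σ * σ = 1 := by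
  rcases h.sign with rfl | rfl <;> norm_num

lemma symm (h : IsReparametrization F F' σ c) : IsReparametrization F' F σ (-(σ * c)) := by
  refine ⟨h.sign, h.length_eq.symm, fun s => ?_⟩
  rw [h.α_eq]
  congr 1
  linear_combination (c - s) * h.mul_self

lemma deriv_α (h : IsReparametrization F F' σ c) (s : ℝ) :
    deriv F'.α s = σ • deriv F.α (σ * s + c) := by
  rw [show F'.α = F.α ∘ fun s => σ * s + c from funext h.α_eq]
  have h1 : HasDerivAt (fun s => σ * s + c) σ s := by
    simpa using ((hasDerivAt_id s).const_mul σ).add_const c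
  exact ((F.hasDerivAt_α (σ * s + c)).scomp s h1).deriv

lemma deriv_deriv_α (h : IsReparametrization F F' σ c) (s : ℝ) :
    deriv (deriv F'.α) s = deriv (deriv F.α) (σ * s + c) := by
  rw [show deriv F'.α = σ • (deriv F.α ∘ fun s => σ * s + c) from funext h.deriv_α]
  have h1 : HasDerivAt (fun s => σ * s + c) σ s := by
    simpa using ((hasDerivAt_id s).const_mul σ).add_const c
  have h2 := (F.contDiff_deriv_α.differentiable (by simp) (σ * s + c)).hasDerivAt
  have h3 := ((h2.scomp s h1).const_smul σ).deriv
  rw [h3, smul_smul, h.mul_self, one_smul]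

lemma ν_eq (h : IsReparametrization F F' σ c) (s : ℝ) : F'.ν s = σ • F.ν (σ * s + c) := by
  unfold FrenetFrame.ν
  rw [h.deriv_α]
  ext i
  fin_cases i <;> simp

lemma κ_eq (h : IsReparametrization F F' σ c) (s : ℝ) : F'.κ s = σ * F.κ (σ * s + c) := by
  unfold FrenetFrame.κ
  rw [h.deriv_α, h.deriv_deriv_α]
  simp only [PiLp.smul_apply, smul_eq_mul]
  ring

lemma point_eq (h : IsReparametrization F F' σ c) (s r : ℝ) :
    F'.point s r = F.point (σ * s + c) (σ * r) := by
  unfold FrenetFrame.point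
  rw [h.α_eq, h.ν_eq, smul_smul, mul_comm r]

lemma normalDeriv_eq (h : IsReparametrization F F' σ c) (G : Fin 2 → Plane → ℂ) (s r : ℝ) :
    F'.normalDeriv G s r = σ * F.normalDeriv G (σ * s + c) (σ * r) := by
  unfold FrenetFrame.normalDeriv
  rw [Finset.mul_sum]
  refine Finset.sum_congr rfl fun i _ => ?_
  rw [h.point_eq, h.ν_eq, PiLp.smul_apply, smul_eq_mul]
  push_cast
  ring

end IsReparametrization

lemma periodic_ν (F : FrenetFrame γ) : Function.Periodic F.ν F.L := fun s => by
  have : deriv F.α (s + F.L) = deriv F.α s := by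
    rw [← deriv_comp_add_const]
    exact congrArg (fun f => deriv f s) (funext F.periodic)
  unfold ν
  rw [this]

lemma periodic_point (F : FrenetFrame γ) (r : ℝ) :
    Function.Periodic (fun s => F.point s r) F.L := fun s => by
  simp only [point, F.periodic s, F.periodic_ν s]

end FrenetFrame

/-! ### Traces under a change of the arc-length parameter -/

section Affine

variable {σ : ℝ} (c : ℝ) {L : ℝ}

lemma measurableEmbedding_affine (hσ : σ = 1 ∨ σ = -1) :
    MeasurableEmbedding fun s : ℝ => σ * s + c := by
  have h0 : σ ≠ 0 := by rcases hσ with rfl | rfl <;> norm_num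
  exact ((Homeomorph.mulLeft₀ σ h0).trans (Homeomorph.addRight c)).measurableEmbedding

lemma measurePreserving_affine (hσ : σ = 1 ∨ σ = -1) :
    MeasurePreserving (fun s : ℝ => σ * s + c) := by
  have h1 : MeasurePreserving fun s : ℝ => s + c := measurePreserving_add_right volume c
  rcases hσ with rfl | rfl
  · simpa using h1
  · have h2 := h1.comp (Measure.measurePreserving_neg (volume : Measure ℝ))
    simpa [Function.comp_def] using h2

/-- The substitution `s ↦ σ s + c` carries the interval of periods `(0, L]` to another one. -/
lemma exists_measurePreserving_Ioc (hσ : σ = 1 ∨ σ = -1) :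
    ∃ a, MeasurePreserving (fun s : ℝ => σ * s + c) (volume.restrict (Set.Ioc 0 L))
      (volume.restrict (Set.Ioc a (a + L))) := by
  have h := (measurePreserving_affine c hσ).restrict_preimage_emb (measurableEmbedding_affine c hσ)
  rcases hσ with rfl | rfl
  · have e : (fun s : ℝ => 1 * s + c) ⁻¹' Set.Ioc c (c + L) = Set.Ioc 0 L := by
      ext s
      simp only [Set.mem_Ioc, Set.mem_preimage]
      constructor <;> rintro ⟨h1, h2⟩ <;> constructor <;> linarith
    exact ⟨c, e ▸ h (Set.Ioc c (c + L))⟩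
  · have e : (fun s : ℝ => -1 * s + c) ⁻¹' Set.Ico (c - L) c = Set.Ioc 0 L := by
      ext s
      simp only [Set.mem_Ioc, Set.mem_Ico, Set.mem_preimage]
      constructor <;> rintro ⟨h1, h2⟩ <;> constructor <;> linarith
    have h1 := h (Set.Ico (c - L) c)
    rw [e, restrict_Ico_eq_restrict_Ioc] at h1
    exact ⟨c - L, by rwa [sub_add_cancel]⟩

lemma eLpNorm_comp_affine (hL : 0 < L) (hσ : σ = 1 ∨ σ = -1) {f : ℝ → ℂ}
    (hf : Function.Periodic f L) :
    eLpNorm (fun s => f (σ * s + c)) 2 (volume.restrict (Set.Ioc 0 L)) =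
      eLpNorm f 2 (volume.restrict (Set.Ioc 0 L)) := by
  obtain ⟨a, ha⟩ := exists_measurePreserving_Ioc (L := L) c hσ
  have h1 := (measurableEmbedding_affine c hσ).eLpNorm_map_measure (g := f) (p := 2)
    (μ := volume.restrict (Set.Ioc 0 L))
  rw [ha.map_eq] at h1
  refine h1.symm.trans ?_
  have : VAddInvariantMeasure (AddSubgroup.zmultiples L) ℝ volume :=
    ⟨fun c s _ => measure_preimage_add _ _ _⟩
  have h0 := isAddFundamentalDomain_Ioc hL 0
  rw [zero_add] at h0
  rw [eLpNorm_eq_lintegral_rpow_enorm_toReal two_ne_zero ENNReal.ofNat_ne_top,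
    eLpNorm_eq_lintegral_rpow_enorm_toReal two_ne_zero ENNReal.ofNat_ne_top]
  congr 1
  refine (isAddFundamentalDomain_Ioc hL a).setLIntegral_eq h0 _ fun g x => ?_
  rw [hf.map_vadd_zmultiples]

lemma memLp_comp_affine (hL : 0 < L) (hσ : σ = 1 ∨ σ = -1) {f : ℝ → ℂ}
    (hf : Function.Periodic f L) (hm : MemLp f 2 (volume.restrict (Set.Ioc 0 L))) :
    MemLp (fun s => f (σ * s + c)) 2 (volume.restrict (Set.Ioc 0 L)) := by
  refine ⟨?_, by rw [eLpNorm_comp_affine c hL hσ hf]; exact hm.2⟩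
  obtain ⟨a, ha⟩ := exists_measurePreserving_Ioc (L := L) c hσ
  have : VAddInvariantMeasure (AddSubgroup.zmultiples L) ℝ volume :=
    ⟨fun c s _ => measure_preimage_add _ _ _⟩
  have h0 := isAddFundamentalDomain_Ioc hL 0
  rw [zero_add] at h0
  exact AEStronglyMeasurable.comp_measurePreserving
    ((h0.aestronglyMeasurable_on_iff (isAddFundamentalDomain_Ioc hL a)
      fun g x => hf.map_vadd_zmultiples g x).1 hm.1) ha

end Affine

namespace FrenetFrame.IsReparametrization

variable {γ : Set Plane} {F F' : FrenetFrame γ} {σ c : ℝ}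

lemma tendsto_mul_ae (h : IsReparametrization F F' σ c) :
    Tendsto (fun r : ℝ => σ * r) (ae volume) (ae volume) := by
  have := (measurePreserving_affine 0 h.sign).quasiMeasurePreserving.tendsto_ae
  simpa using this

lemma periodic_comp (h : IsReparametrization F F' σ c) {β : Type*} {f : ℝ → β}
    (hf : Function.Periodic f F.L) : Function.Periodic (fun s => f (σ * s + c)) F'.L := fun s => by
  simp only [h.length_eq]
  rcases h.sign with rfl | rfl
  · rw [← hf (1 * s + c)]; congr 1; ring
  · rw [← hf (-1 * (s + F.L) + c)]; congr 1; ring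

/-- Traces are taken to traces by a change of the arc-length parameter, from the side that
corresponds under `r ↦ σ r`. -/
lemma hasTrace (h : IsReparametrization F F' σ c) {side side' : Filter ℝ}
    (hs : Tendsto (fun r : ℝ => σ * r) side' side) {u : ℝ → ℝ → ℂ} {g : ℝ → ℂ}
    (hu : ∀ r, Function.Periodic (fun s => u s r) F.L) (hg : F.HasTrace side u g) :
    F'.HasTrace side' (fun s r => u (σ * s + c) (σ * r)) (fun s => g (σ * s + c)) := by
  obtain ⟨gp, gm, gt⟩ := hg
  refine ⟨h.periodic_comp gp, ?_, ?_⟩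
  · rw [h.length_eq]
    exact memLp_comp_affine c F.L_pos h.sign gp gm
  · refine (gt.comp (hs.inf h.tendsto_mul_ae)).congr fun r => ?_
    rw [h.length_eq]
    exact (eLpNorm_comp_affine c F.L_pos h.sign ((hu (σ * r)).sub gp)).symm

lemma hasTrace_point (h : IsReparametrization F F' σ c) {side side' : Filter ℝ}
    (hs : Tendsto (fun r : ℝ => σ * r) side' side) {u : Plane → ℂ} {g : ℝ → ℂ}
    (hg : F.HasTrace side (fun s r => u (F.point s r)) g) :
    F'.HasTrace side' (fun s r => u (F'.point s r)) (fun s => g (σ * s + c)) := by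
  simp only [h.point_eq]
  refine h.hasTrace (u := fun s r => u (F.point s r)) hs (fun r s => ?_) hg
  simp only [F.periodic_point r s]

lemma hasTrace_normalDeriv (h : IsReparametrization F F' σ c) {side side' : Filter ℝ}
    (hs : Tendsto (fun r : ℝ => σ * r) side' side) {G : Fin 2 → Plane → ℂ} {g : ℝ → ℂ}
    (hg : F.HasTrace side (F.normalDeriv G) g) :
    F'.HasTrace side' (F'.normalDeriv G) (fun s => σ * g (σ * s + c)) := by
  rw [show F'.normalDeriv G = fun s r => σ * F.normalDeriv G (σ * s + c) (σ * r) from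
    funext fun s => funext fun r => h.normalDeriv_eq G s r]
  refine SchrodingerCurve.hasTrace_const_mul _ (h.hasTrace hs (fun r s => ?_) hg)
  simp only [FrenetFrame.normalDeriv, F.periodic_point r s, F.periodic_ν s]

end FrenetFrame.IsReparametrization

lemma tendsto_neg_one_mul_nhdsGT : Tendsto (fun r : ℝ => -1 * r) (𝓝[>] 0) (𝓝[<] 0) := by
  simpa using tendsto_neg_nhdsGT (a := (0 : ℝ))

lemma tendsto_neg_one_mul_nhdsLT : Tendsto (fun r : ℝ => -1 * r) (𝓝[<] 0) (𝓝[>] 0) := by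
  simpa using tendsto_neg_nhdsLT (a := (0 : ℝ))

namespace FrenetFrame

variable {γ : Set Plane} (F : FrenetFrame γ)

lemma hasTrace_reverse_iff {side side' : Filter ℝ}
    (hs : Tendsto (fun r : ℝ => -1 * r) side' side) (hs' : Tendsto (fun r : ℝ => -1 * r) side side')
    (u : Plane → ℂ) (g : ℝ → ℂ) :
    F.reverse.HasTrace side' (fun s r => u (F.reverse.point s r)) g ↔
      F.HasTrace side (fun s r => u (F.point s r)) (fun s => g (-s)) := by
  refine ⟨fun h => ?_, fun h => ?_⟩
  · simpa using F.isReparametrization_reverse.symm.hasTrace_point hs' h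
  · simpa using F.isReparametrization_reverse.hasTrace_point hs h

lemma hasTrace_normalDeriv_reverse_iff {side side' : Filter ℝ}
    (hs : Tendsto (fun r : ℝ => -1 * r) side' side) (hs' : Tendsto (fun r : ℝ => -1 * r) side side')
    (G : Fin 2 → Plane → ℂ) (g : ℝ → ℂ) :
    F.reverse.HasTrace side' (F.reverse.normalDeriv G) g ↔
      F.HasTrace side (F.normalDeriv G) (fun s => -g (-s)) := by
  refine ⟨fun h => ?_, fun h => ?_⟩
  · simpa using F.isReparametrization_reverse.symm.hasTrace_normalDeriv hs' h
  · simpa using F.isReparametrization_reverse.hasTrace_normalDeriv hs h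

end FrenetFrame

/-! ### Half-bound states -/

/-- A solution of `h'' = V h` with a bounded potential is determined by its Cauchy data. -/
lemma eq_of_second_order_ode {V h k : ℝ → ℝ} {C : ℝ} (hV : ∀ r, |V r| ≤ C)
    (hs : ContDiff ℝ 2 h) (ks : ContDiff ℝ 2 k) (he : ∀ r, deriv (deriv h) r = V r * h r)
    (ke : ∀ r, deriv (deriv k) r = V r * k r) {a : ℝ} (h0 : h a = k a)
    (h1 : deriv h a = deriv k a) : h = k := by
  let v : ℝ → ℝ × ℝ → ℝ × ℝ := fun r p => (p.2, V r * p.1)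
  have hv : ∀ r, LipschitzOnWith (max 1 C).toNNReal (v r) Set.univ := fun r => by
    refine LipschitzOnWith.of_dist_le_mul fun p _ q _ => ?_
    rw [Real.coe_toNNReal _ (le_max_of_le_left zero_le_one), Prod.dist_eq, Prod.dist_eq]
    refine max_le ?_ ?_
    · calc dist p.2 q.2 = 1 * dist p.2 q.2 := (one_mul _).symm
        _ ≤ _ := mul_le_mul (le_max_left _ _) (le_max_right _ _) dist_nonneg
            (le_max_of_le_left zero_le_one)
    · calc dist (V r * p.1) (V r * q.1) = |V r| * dist p.1 q.1 := by
            rw [Real.dist_eq, ← mul_sub, abs_mul, Real.dist_eq]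
        _ ≤ _ := mul_le_mul ((hV r).trans (le_max_right _ _)) (le_max_left _ _) dist_nonneg
            (le_max_of_le_left zero_le_one)
  have key : ∀ {f : ℝ → ℝ}, ContDiff ℝ 2 f → (∀ r, deriv (deriv f) r = V r * f r) →
      ∀ r, HasDerivAt (fun r => (f r, deriv f r)) (v r (f r, deriv f r)) r ∧
        (f r, deriv f r) ∈ Set.univ := fun {f} fs fe r => by
    refine ⟨((fs.differentiable (by simp) r).hasDerivAt).prodMk ?_, Set.mem_univ _⟩
    have h2 : ContDiff ℝ 1 (deriv f) :=
      (contDiff_succ_iff_deriv.1 (one_add_one_eq_two (R := WithTop ℕ∞) ▸ fs)).2.2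
    rw [← fe r]
    exact (h2.differentiable (by simp) r).hasDerivAt
  have := ODE_solution_unique_univ hv (key hs he) (key ks ke) (t₀ := a) (by simp [h0, h1])
  exact funext fun r => congrArg Prod.fst (congrFun this r)

lemma exists_bound_of_support_Icc {V : ℝ → ℝ} (hV : Continuous V)
    (h0 : ∀ n, n ∉ Set.Icc (-1 : ℝ) 1 → V n = 0) : ∃ C, ∀ r, |V r| ≤ C := by
  have hc : HasCompactSupport V := HasCompactSupport.intro isCompact_Icc fun {n} hn => h0 n hn
  exact hc.exists_bound_of_continuous hV

namespace IsHalfBoundState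

variable {V h : ℝ → ℝ}

lemma deriv_deriv (hh : IsHalfBoundState V h) (r : ℝ) : deriv (deriv h) r = V r * h r := by
  linarith [hh.equation r]

lemma contDiff_deriv (hh : IsHalfBoundState V h) : ContDiff ℝ 1 (deriv h) :=
  (contDiff_succ_iff_deriv.1 (one_add_one_eq_two (R := WithTop ℕ∞) ▸ hh.smooth)).2.2

lemma comp_neg (hh : IsHalfBoundState V h) :
    IsHalfBoundState (fun r => V (-r)) (fun r => h (-r)) := by
  refine ⟨hh.smooth.comp contDiff_neg, fun r => ?_, ?_, ?_⟩
  · have h1 : deriv (fun r => h (-r)) = fun r => -deriv h (-r) :=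
      funext fun r => deriv_comp_neg _ _
    have h2 : deriv (fun r => -deriv h (-r)) r = deriv (deriv h) (-r) := by
      rw [show (fun r => -deriv h (-r)) = -(fun r => deriv h (-r)) from rfl, deriv.neg,
        deriv_comp_neg, neg_neg]
    rw [h1, h2]
    exact hh.equation (-r)
  · obtain ⟨r, hr⟩ := hh.nontrivial
    exact ⟨-r, by rwa [neg_neg]⟩
  · obtain ⟨C, hC⟩ := hh.bounded
    exact ⟨C, fun r => hC (-r)⟩

/-- To the right of the support of the potential a half-bound state is affine and bounded, hence
constant. -/
lemma eq_const_right (hh : IsHalfBoundState V h) (h0 : ∀ r, 1 < r → V r = 0) {r : ℝ}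
    (hr : 1 < r) : h r = h 2 ∧ deriv h r = 0 := by
  have hd : Differentiable ℝ h := hh.smooth.differentiable (by simp)
  have hd' : Differentiable ℝ (deriv h) := hh.contDiff_deriv.differentiable (by simp)
  have h2 : (2 : ℝ) ∈ Set.Ioi (1 : ℝ) := by norm_num
  have hm : ∀ x ∈ Set.Ioi (1 : ℝ), deriv h x = deriv h 2 := fun x hx =>
    isOpen_Ioi.is_const_of_deriv_eq_zero isPreconnected_Ioi hd'.differentiableOn
      (fun y hy => by rw [hh.deriv_deriv, h0 y hy, zero_mul, Pi.zero_apply]) hx h2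
  set m := deriv h 2 with hmdef
  have hlin : ∀ x ∈ Set.Ioi (1 : ℝ), h x = h 2 + m * (x - 2) := fun x hx => by
    have hdk : Differentiable ℝ fun y => h y - m * y := hd.sub (by fun_prop)
    have := isOpen_Ioi.is_const_of_deriv_eq_zero isPreconnected_Ioi hdk.differentiableOn
      (fun y hy => by
        have h1 := ((hd y).hasDerivAt.sub ((hasDerivAt_id y).const_mul m)).deriv
        rw [hm y hy, mul_one, sub_self] at h1
        exact h1) hx h2
    linarith
  obtain ⟨C, hC⟩ := hh.bounded
  have hm0 : m = 0 := by
    by_contra hne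
    have hpos : 0 < |m| := abs_pos.2 hne
    have hC0 : 0 ≤ C := (abs_nonneg _).trans (hC 0)
    -- at this point the affine function exceeds the bound `C`
    have hx0 : 0 ≤ (2 * C + 1) / |m| := by positivity
    have h3 := hlin (2 + (2 * C + 1) / |m|) (by rw [Set.mem_Ioi]; linarith)
    have h4 : |m * ((2 * C + 1) / |m|)| = 2 * C + 1 := by
      rw [abs_mul, abs_of_nonneg hx0, mul_div_cancel₀ _ hpos.ne']
    have h5 : m * ((2 * C + 1) / |m|) = h (2 + (2 * C + 1) / |m|) - h 2 := by
      rw [h3]; ring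
    have h6 := abs_sub (h (2 + (2 * C + 1) / |m|)) (h 2)
    rw [← h5, h4] at h6
    linarith [hC (2 + (2 * C + 1) / |m|), hC 2]
  refine ⟨?_, ?_⟩
  · rw [hlin r hr, hm0, zero_mul, add_zero]
  · rw [hm r hr, hm0]

lemma limUnder_atTop (hh : IsHalfBoundState V h) (h0 : ∀ n, n ∉ Set.Icc (-1 : ℝ) 1 → V n = 0) :
    limUnder atTop h = h 2 := by
  refine Tendsto.limUnder_eq (tendsto_const_nhds.congr' ?_)
  filter_upwards [eventually_gt_atTop (1 : ℝ)] with r hr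
  exact (hh.eq_const_right (fun r hr => h0 r fun h => hr.not_ge h.2) hr).1.symm

lemma limUnder_atBot (hh : IsHalfBoundState V h) (h0 : ∀ n, n ∉ Set.Icc (-1 : ℝ) 1 → V n = 0) :
    limUnder atBot h = h (-2) := by
  refine Tendsto.limUnder_eq (tendsto_const_nhds.congr' ?_)
  filter_upwards [eventually_lt_atBot (-1 : ℝ)] with r hr
  have h1 := (hh.comp_neg.eq_const_right
    (fun r hr => h0 (-r) fun h => by linarith [h.1]) (r := -r) (by linarith)).1
  rw [neg_neg] at h1
  exact h1.symm

/-- To the right of the support of the potential a half-bound state does not vanish: otherwise its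
Cauchy data are zero there. -/
lemma ne_zero_right (hh : IsHalfBoundState V h) (hV : Continuous V)
    (h0 : ∀ n, n ∉ Set.Icc (-1 : ℝ) 1 → V n = 0) : h 2 ≠ 0 := fun h2 => by
  obtain ⟨C, hC⟩ := exists_bound_of_support_Icc hV h0
  have h1 := (hh.eq_const_right (fun r hr => h0 r fun h => hr.not_ge h.2) one_lt_two).2
  obtain ⟨r, hr⟩ := hh.nontrivial
  exact hr (congrFun (eq_of_second_order_ode hC hh.smooth (k := fun _ => 0) contDiff_const
    hh.deriv_deriv (fun r => by simp) (a := 2) h2 (by simp [h1])) r)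

/-- The half-bound state is unique up to a factor: to the right of the support of the potential all
half-bound states are constant, so their Cauchy data are proportional. -/
lemma exists_smul_eq (hh : IsHalfBoundState V h) {k : ℝ → ℝ} (hk : IsHalfBoundState V k)
    (hV : Continuous V) (h0 : ∀ n, n ∉ Set.Icc (-1 : ℝ) 1 → V n = 0) :
    ∃ a, a ≠ 0 ∧ k = fun r => a * h r := by
  obtain ⟨C, hC⟩ := exists_bound_of_support_Icc hV h0
  have hright : ∀ r, 1 < r → V r = 0 := fun r hr => h0 r fun h => hr.not_ge h.2
  have h1 := (hh.eq_const_right hright one_lt_two).2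
  have k1 := (hk.eq_const_right hright one_lt_two).2
  have hne : h 2 ≠ 0 := hh.ne_zero_right hV h0
  have hd : deriv (fun r => k 2 / h 2 * h r) = fun r => k 2 / h 2 * deriv h r :=
    funext fun r => deriv_const_mul_field _
  have hk' : k = fun r => k 2 / h 2 * h r := by
    refine eq_of_second_order_ode hC hk.smooth (contDiff_const.mul hh.smooth) hk.deriv_deriv
      (fun r => ?_) (a := 2) (by rw [div_mul_cancel₀ _ hne]) ?_
    · rw [hd, deriv_const_mul_field, hh.deriv_deriv]
      ring
    · rw [hd, k1]
      simp [h1]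
  exact ⟨k 2 / h 2, div_ne_zero (hk.ne_zero_right hV h0) hne, hk'⟩

end IsHalfBoundState

namespace Profile

variable {L : ℝ} (P : Profile L) {h : ℝ → ℝ}

lemma halfBoundState_ne_zero_left (hh : IsHalfBoundState P.V h) : h (-2) ≠ 0 :=
  IsHalfBoundState.ne_zero_right (V := P.reverse.V) hh.comp_neg P.reverse.smooth_V.continuous
    P.reverse.supp_V

lemma halfBoundState_ne_zero_right (hh : IsHalfBoundState P.V h) : h 2 ≠ 0 :=
  hh.ne_zero_right P.smooth_V.continuous P.supp_V

lemma thetaOf_eq (hh : IsHalfBoundState P.V h) : thetaOf h = h 2 / h (-2) := by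
  rw [thetaOf, hh.limUnder_atTop P.supp_V, hh.limUnder_atBot P.supp_V]

lemma thetaOf_ne_zero (hh : IsHalfBoundState P.V h) : thetaOf h ≠ 0 := by
  rw [P.thetaOf_eq hh]
  exact div_ne_zero (P.halfBoundState_ne_zero_right hh) (P.halfBoundState_ne_zero_left hh)

lemma muOf_eq (hh : IsHalfBoundState P.V h) (U : ℝ → ℝ → ℝ) (s : ℝ) :
    muOf U h s = 1 / h (-2) ^ 2 * ∫ r, U s r * h r ^ 2 := by
  rw [muOf, hh.limUnder_atBot P.supp_V]

/-- `θ` and `μ` do not depend on the choice of the half-bound state. -/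
lemma thetaOf_muOf_unique (hh : IsHalfBoundState P.V h) {k : ℝ → ℝ}
    (hk : IsHalfBoundState P.V k) (U : ℝ → ℝ → ℝ) :
    thetaOf k = thetaOf h ∧ muOf U k = muOf U h := by
  obtain ⟨a, ha, e⟩ := hh.exists_smul_eq hk P.smooth_V.continuous P.supp_V
  have hl := P.halfBoundState_ne_zero_left hh
  refine ⟨?_, funext fun s => ?_⟩
  · rw [P.thetaOf_eq hh, P.thetaOf_eq hk, e, mul_div_mul_left _ _ ha]
  · rw [P.muOf_eq hh, P.muOf_eq hk, e]
    have : ∀ r, U s r * (a * h r) ^ 2 = a ^ 2 * (U s r * h r ^ 2) := fun r => by ring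
    simp only [this, integral_const_mul]
    field_simp

lemma thetaOf_neg (hh : IsHalfBoundState P.V h) :
    thetaOf (fun r => h (-r)) = (thetaOf h)⁻¹ := by
  rw [P.reverse.thetaOf_eq hh.comp_neg, P.thetaOf_eq hh, inv_div, neg_neg]

lemma muOf_neg (hh : IsHalfBoundState P.V h) (U : ℝ → ℝ → ℝ) (s t : ℝ) :
    muOf (fun _ n => U t (-n)) (fun r => h (-r)) s = (thetaOf h ^ 2)⁻¹ * muOf U h t := by
  have hl := P.halfBoundState_ne_zero_left hh
  have hr := P.halfBoundState_ne_zero_right hh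
  rw [P.reverse.muOf_eq hh.comp_neg, P.thetaOf_eq hh, P.muOf_eq hh,
    integral_neg_eq_self (fun r => U t r * h r ^ 2) volume, neg_neg]
  field_simp

end Profile

/-! ### The profiles are determined by the potentials -/

section Profiles

variable {γ : Set Plane}

/-- The leading terms as `ε → 0` of the potentials at the points with the normal coordinate `ε n`
determine `V`, the remainder determines `U`. -/
lemma IsPotentialFamily.profile_eq {F F' : FrenetFrame γ} {σ c : ℝ}
    (hR : F.IsReparametrization F' σ c) {P : Profile F.L} {P' : Profile F'.L}
    {Vε : ℝ → Plane → ℝ} (hP : IsPotentialFamily F P Vε) (hP' : IsPotentialFamily F' P' Vε) :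
    (∀ n, P'.V n = P.V (σ * n)) ∧ ∀ s n, P'.U s n = P.U (σ * s + c) (σ * n) := by
  have hmem : ∀ {x y : ℝ}, x ∈ Set.Ioo (-y) y → σ * x ∈ Set.Ioo (-y) y := fun {x y} hx => by
    rcases hR.sign with rfl | rfl
    · simpa using hx
    · exact ⟨by linarith [hx.2], by linarith [hx.1]⟩
  have hnot : ∀ {n : ℝ}, n ∉ Set.Icc (-1 : ℝ) 1 → σ * n ∉ Set.Icc (-1 : ℝ) 1 := fun {n} hn => by
    rcases hR.sign with rfl | rfl
    · simpa using hn
    · exact fun h => hn ⟨by linarith [h.2], by linarith [h.1]⟩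
  have hlim : ∀ s, ∀ n ∈ Set.Ioo (-1 : ℝ) 1, ∀ᶠ ε in 𝓝[>] (0 : ℝ), 0 < ε ∧
      P'.V n - P.V (σ * n) + ε * (P'.U s n - P.U (σ * s + c) (σ * n)) = 0 := fun s n hn => by
    filter_upwards [hP, hP', self_mem_nhdsWithin] with ε h1 h2 hε
    have hε : 0 < ε := hε
    have hr : ε * n ∈ Set.Ioo (-ε) ε := ⟨by nlinarith [hn.1], by nlinarith [hn.2]⟩
    have e1 := h1.1 (σ * s + c) (σ * (ε * n)) (hmem hr)
    have e2 := h2.1 s (ε * n) hr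
    rw [← hR.point_eq] at e1
    rw [e1, mul_left_comm σ ε n, inv_mul_cancel_left₀ hε.ne', inv_mul_cancel_left₀ hε.ne'] at e2
    refine ⟨hε, ?_⟩
    field_simp at e2
    linarith
  have hV : ∀ n ∈ Set.Ioo (-1 : ℝ) 1, P'.V n = P.V (σ * n) := fun n hn => by
    have h1 : Tendsto (fun ε : ℝ =>
        P'.V n - P.V (σ * n) + ε * (P'.U 0 n - P.U (σ * 0 + c) (σ * n))) (𝓝[>] 0)
        (𝓝 (P'.V n - P.V (σ * n) + 0 * (P'.U 0 n - P.U (σ * 0 + c) (σ * n)))) :=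
      Tendsto.mono_left (Continuous.tendsto (by fun_prop) 0) nhdsWithin_le_nhds
    have h2 := tendsto_nhds_unique_of_eventuallyEq h1 (tendsto_const_nhds (x := (0 : ℝ)))
      ((hlim 0 n hn).mono fun ε h => h.2)
    linarith
  have hU : ∀ s, ∀ n ∈ Set.Ioo (-1 : ℝ) 1, P'.U s n = P.U (σ * s + c) (σ * n) :=
    fun s n hn => by
    obtain ⟨ε, hε, h1⟩ := (hlim s n hn).exists
    rw [hV n hn, sub_self, zero_add] at h1
    linarith [(mul_eq_zero.1 h1).resolve_left hε.ne']
  -- the equalities extend by continuity to the endpoints `n = ±1`, which the potentials do not see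
  have hdense : Dense ({-1, 1}ᶜ : Set ℝ) :=
    (Set.toFinite ({-1, 1} : Set ℝ)).countable.dense_compl ℝ
  have hcase : ∀ n ∈ ({-1, 1}ᶜ : Set ℝ), n ∈ Set.Ioo (-1 : ℝ) 1 ∨ n ∉ Set.Icc (-1 : ℝ) 1 :=
    fun n hn => by
    simp only [Set.mem_compl_iff, Set.mem_insert_iff, Set.mem_singleton_iff, not_or] at hn
    refine (em (n ∈ Set.Icc (-1 : ℝ) 1)).imp (fun h => ⟨?_, ?_⟩) id
    · exact lt_of_le_of_ne h.1 fun h => hn.1 h.symm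
    · exact lt_of_le_of_ne h.2 hn.2
  have hUc : ∀ {L : ℝ} (Q : Profile L) (s : ℝ), Continuous (Q.U s) := fun Q s =>
    Q.smooth_U.continuous.comp (Continuous.prodMk_right s)
  refine ⟨fun n => ?_, fun s n => ?_⟩
  · refine congrFun (Continuous.ext_on hdense P'.smooth_V.continuous
      (P.smooth_V.continuous.comp (continuous_const_mul σ)) fun n hn => ?_) n
    rcases hcase n hn with h | h
    · exact hV n h
    · exact (P'.supp_V n h).trans (P.supp_V _ (hnot h)).symm
  · refine congrFun (Continuous.ext_on hdense (hUc P' s)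
      ((hUc P (σ * s + c)).comp (continuous_const_mul σ)) fun n hn => ?_) n
    rcases hcase n hn with h | h
    · exact hU s n h
    · exact (P'.supp_U s n h).trans (P.supp_U _ _ (hnot h)).symm

lemma IsPotentialFamily.reverse {F : FrenetFrame γ} {P : Profile F.L} {Vε : ℝ → Plane → ℝ}
    (hP : IsPotentialFamily F P Vε) : IsPotentialFamily F.reverse P.reverse Vε := by
  refine hP.mono fun ε h => ⟨fun s r hr => ?_, h.2⟩
  rw [F.isReparametrization_reverse.point_eq, h.1 _ _ ⟨by linarith [hr.2], by linarith [hr.1]⟩]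
  simp [Profile.reverse]

end Profiles

/-! ### Transmission conditions -/

/-- With the opposite normal the two sides of the curve are exchanged, and the normal derivatives
change sign. -/
lemma transmissionConditions_reverse_iff {θ : ℝ} (hθ : θ ≠ 0) (κ μ : ℝ) (vp vm dp dm : ℂ) :
    TransmissionConditions θ⁻¹ (-κ) ((θ ^ 2)⁻¹ * μ) vm vp (-dm) (-dp) ↔
      TransmissionConditions θ κ μ vp vm dp dm := by
  have hθ' : (θ : ℂ) ≠ 0 := Complex.ofReal_ne_zero.2 hθ
  unfold TransmissionConditions
  have h1 : vm = ((θ⁻¹ : ℝ) : ℂ) * vp ↔ vp = θ * vm := by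
    push_cast
    rw [eq_comm, inv_mul_eq_iff_eq_mul₀ hθ']
  rw [h1]
  refine and_congr_right fun h2 => ?_
  rw [h2]
  push_cast
  constructor <;> intro h3
  · field_simp at h3 ⊢
    linear_combination h3
  · field_simp at h3 ⊢
    linear_combination h3

section Domain

variable {γ : Set Plane} {F F' : FrenetFrame γ} {c θ : ℝ} {μ : ℝ → ℝ} {v : L2Plane}

lemma SatisfiesTransmission.shift (hR : F.IsReparametrization F' 1 c)
    (hv : SatisfiesTransmission F θ μ v) :
    SatisfiesTransmission F' θ (fun s => μ (1 * s + c)) v := by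
  obtain ⟨u, G, vp, vm, dp, dm, mu, mG, e, w, a1, a2, a3, a4, a5⟩ := hv
  have hp : ∀ side : Filter ℝ, Tendsto (fun r : ℝ => 1 * r) side side := fun side =>
    tendsto_id.congr fun r => (one_mul r).symm
  refine ⟨u, G, _, _, _, _, mu, mG, e, w, hR.hasTrace_point (hp _) a1, hR.hasTrace_point (hp _) a2,
    hR.hasTrace_normalDeriv (hp _) a3, hR.hasTrace_normalDeriv (hp _) a4, ?_⟩
  filter_upwards [(measurePreserving_affine c hR.sign).quasiMeasurePreserving.ae a5] with s hs
  simpa only [hR.κ_eq, one_mul, Complex.ofReal_one] using hs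

lemma SatisfiesTransmission.reflect (hR : F.IsReparametrization F' (-1) c) (hθ : θ ≠ 0)
    (hv : SatisfiesTransmission F θ μ v) :
    SatisfiesTransmission F' θ⁻¹ (fun s => (θ ^ 2)⁻¹ * μ (-1 * s + c)) v := by
  obtain ⟨u, G, vp, vm, dp, dm, mu, mG, e, w, a1, a2, a3, a4, a5⟩ := hv
  refine ⟨u, G, _, _, _, _, mu, mG, e, w, hR.hasTrace_point tendsto_neg_one_mul_nhdsGT a2,
    hR.hasTrace_point tendsto_neg_one_mul_nhdsLT a1,
    hR.hasTrace_normalDeriv tendsto_neg_one_mul_nhdsGT a4,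
    hR.hasTrace_normalDeriv tendsto_neg_one_mul_nhdsLT a3, ?_⟩
  filter_upwards [(measurePreserving_affine c hR.sign).quasiMeasurePreserving.ae a5] with s hs
  have := (transmissionConditions_reverse_iff hθ _ _ _ _ _ _).2 hs
  simpa only [hR.κ_eq, neg_mul, one_mul, Complex.ofReal_neg, Complex.ofReal_one] using this

lemma limitDomain_le {P : Profile F.L} {P' : Profile F'.L} {h h' : ℝ → ℝ}
    (B : BackgroundPotential γ) {Vε : ℝ → Plane → ℝ}
    (hP : IsPotentialFamily F P Vε) (hP' : IsPotentialFamily F' P' Vε)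
    (hh : IsHalfBoundState P.V h) (hh' : IsHalfBoundState P'.V h') :
    limitDomain F P h B ≤ limitDomain F' P' h' B := by
  obtain ⟨σ, c, hR⟩ := F.exists_isReparametrization F'
  obtain ⟨eV, eU⟩ := hP.profile_eq hR hP'
  refine fun v hv => ⟨hv.1, ?_⟩
  have hv2 : SatisfiesTransmission F (thetaOf h) (muOf P.U h) v := hv.2
  rcases hR.sign with rfl | rfl
  · have hV : P'.V = P.V := funext fun n => by rw [eV, one_mul]
    obtain ⟨eθ, eμ⟩ := P.thetaOf_muOf_unique hh (hV ▸ hh') P'.U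
    rw [eθ, eμ, show muOf P'.U h = fun s => muOf P.U h (1 * s + c) from funext fun s => by
      simp only [muOf, eU, one_mul]]
    exact hv2.shift hR
  · have hV : P'.V = P.reverse.V := funext fun n => by rw [eV, neg_one_mul]; rfl
    obtain ⟨eθ, eμ⟩ := P.reverse.thetaOf_muOf_unique hh.comp_neg (hV ▸ hh') P'.U
    rw [eθ, eμ, P.thetaOf_neg hh, show muOf P'.U (fun r => h (-r)) =
        fun s => (thetaOf h ^ 2)⁻¹ * muOf P.U h (-1 * s + c) from funext fun s => by
      rw [← P.muOf_neg hh P.U s]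
      simp only [muOf, eU, neg_one_mul]]
    exact hv2.reflect hR (P.thetaOf_ne_zero hh)

lemma limitOperator_eq {P : Profile F.L} {P' : Profile F'.L} {h h' : ℝ → ℝ}
    (B : BackgroundPotential γ) {Vε : ℝ → Plane → ℝ}
    (hP : IsPotentialFamily F P Vε) (hP' : IsPotentialFamily F' P' Vε)
    (hh : IsHalfBoundState P.V h) (hh' : IsHalfBoundState P'.V h') :
    limitOperator F' P' h' B = limitOperator F P h B :=
  LinearPMap.ext (le_antisymm (limitDomain_le B hP' hP hh' hh) (limitDomain_le B hP hP' hh hh'))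
    fun _ hf hg => SchrodingerCurve.weakAction_unique F B.W
      (limitOperator_spec F' P' h' B ⟨_, hf⟩) (limitOperator_spec F P h B ⟨_, hg⟩)

end Domain

theorem mainTheorem4 (γ : Set Plane) (B : BackgroundPotential γ) (Vε : ℝ → Plane → ℝ)
    (F : FrenetFrame γ) (P : Profile F.L) (hP : IsPotentialFamily F P Vε)
    (h : ℝ → ℝ) (hh : IsHalfBoundState P.V h) :
    (∀ (F' : FrenetFrame γ) (P' : Profile F'.L) (h' : ℝ → ℝ),
      IsPotentialFamily F' P' Vε → IsHalfBoundState P'.V h' →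
        limitOperator F' P' h' B = limitOperator F P h B) ∧
    (IsPotentialFamily F.reverse P.reverse Vε ∧
      IsHalfBoundState P.reverse.V (fun r => h (-r)) ∧
      thetaOf (fun r => h (-r)) = (thetaOf h)⁻¹ ∧
      (∀ s, F.reverse.κ s = -F.κ (-s)) ∧
      (∀ s, muOf P.reverse.U (fun r => h (-r)) s = (thetaOf h ^ 2)⁻¹ * muOf P.U h (-s)) ∧
      (∀ (u : Plane → ℂ) (g : ℝ → ℂ),
        (F.reverse.HasTracePlus u g ↔ F.HasTraceMinus u (fun s => g (-s))) ∧
        (F.reverse.HasTraceMinus u g ↔ F.HasTracePlus u (fun s => g (-s)))) ∧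
      (∀ (G : Fin 2 → Plane → ℂ) (g : ℝ → ℂ),
        (F.reverse.HasNormalTracePlus G g ↔ F.HasNormalTraceMinus G (fun s => -g (-s))) ∧
        (F.reverse.HasNormalTraceMinus G g ↔ F.HasNormalTracePlus G (fun s => -g (-s)))) ∧
      (∀ (s : ℝ) (vp vm dp dm : ℂ),
        TransmissionConditions (thetaOf fun r => h (-r)) (F.reverse.κ s)
            (muOf P.reverse.U (fun r => h (-r)) s) vm vp (-dm) (-dp) ↔
          TransmissionConditions (thetaOf h) (F.κ (-s)) (muOf P.U h (-s)) vp vm dp dm)) := by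
  have hμ : ∀ s, muOf P.reverse.U (fun r => h (-r)) s
      = (thetaOf h ^ 2)⁻¹ * muOf P.U h (-s) := fun s => P.muOf_neg hh P.U s (-s)
  have hκ : ∀ s, F.reverse.κ s = -F.κ (-s) := fun s => by
    simpa using F.isReparametrization_reverse.κ_eq s
  refine ⟨fun F' P' h' hP' hh' => limitOperator_eq B hP hP' hh hh', hP.reverse, hh.comp_neg,
    P.thetaOf_neg hh, hκ, hμ, fun u g => ⟨?_, ?_⟩, fun G g => ⟨?_, ?_⟩, fun s vp vm dp dm => ?_⟩
  · exact F.hasTrace_reverse_iff tendsto_neg_one_mul_nhdsGT tendsto_neg_one_mul_nhdsLT u g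
  · exact F.hasTrace_reverse_iff tendsto_neg_one_mul_nhdsLT tendsto_neg_one_mul_nhdsGT u g
  · exact F.hasTrace_normalDeriv_reverse_iff tendsto_neg_one_mul_nhdsGT
      tendsto_neg_one_mul_nhdsLT G g
  · exact F.hasTrace_normalDeriv_reverse_iff tendsto_neg_one_mul_nhdsLT
      tendsto_neg_one_mul_nhdsGT G g
  · rw [P.thetaOf_neg hh, hκ, hμ]
    exact transmissionConditions_reverse_iff (P.thetaOf_ne_zero hh) _ _ _ _ _ _
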